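/- Let $\lambda,\mu:[0,1]\to\mathbb R$ be Lipschitz continuous and positive, let $q,\rho,\epsilon\in\mathbb R$ with $q\neq0$ and $1-\frac1{|\rho q|}<\epsilon\le 1$ (if $\rho=0$, the first inequality is regarded as satisfied), and put $\tau=\int_0^1\frac{dx}{\lambda(x)}+\int_0^1\frac{dx}{\mu(x)}$. Given $f_i,g_i:[0,1]\to\mathbb R$, $i=1,\dots,4$, consider for $t\ge0$, $x\in[0,1]$ the system $$\alpha_t+\lambda(x)\alpha_x=n(t)f_1(x)+d_1(t)f_2(x)+d_2(t)f_3(x)+d_4(t)f_4(x),$$ $$\beta_t-\mu(x)\beta_x=n(t)g_1(x)+d_1(t)g_2(x)+d_2(t)g_3(x)+d_4(t)g_4(x),$$ $$\alpha(t,0)=q\beta(t,0)+d_3(t),\qquad \beta(t,1)=\rho(1-\epsilon)\alpha(t,1)+d_4(t)-\rho\epsilon n(t),$$ $$\alpha(0,\cdot)=\alpha^0,\qquad \beta(0,\cdot)=\beta^0 .$$ A solution is a pair $(\alpha,\beta)$ such that $\alpha(t,\cdot),\beta(t,\cdot)\in L^\infty(0,1)$ for all $t\ge0$, $t\mapsto\alpha(t,\cdot)$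 and $t\mapsto\beta(t,\cdot)$ are continuous into $L^1(0,1)$, the two equations hold in integrated form along each characteristic ($x'=\lambda(x)$, respectively $x'=-\mu(x)$), the boundary conditions hold for almost every $t>0$, and the initial conditions hold almost everywhere. A function $h:[0,\infty)\to\mathbb R$ is of class $\mathcal K$ if it is continuous, strictly increasing and $h(0)=0$; $h:[0,\infty)^2\to\mathbb R$ is of class $\mathcal{KL}$ if $h(\cdot,t)$ is of class $\mathcal K$ for each $t$ and $h(r,\cdot)$ is nonincreasing with limit $0$ at $\infty$ for each $r$. The system is said to be input-to-state stable with respect to $n,d_1,\dots,d_4$ with rate $\nu>0$ and gain $h_2\in\mathcal K$ if there is $h_1\in\mathcal{KL}$ such that, for all $\alpha^0,\beta^0\in L^\infty(0,1)$ and all measurable, locally essentially bounded $n,d_1,\dots,d_4$ on $(0,\infty)$, a solution exists, and every solution satisfies, for all $t\ge0$, $$\|(\alpha,\beta)(t,\cdot)\|_{L^\infty((0,1);\mathbb R^2)}\le h_2\big(\|(n,d_1,\dots,d_4)\|_{L^\infty((0,t);\mathbb R^5)}\big)+h_1\big(\|(\alpha^0,\beta^0)\|_{L^\infty((0,1);\mathbb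 R^2)},t\big),$$ where $h_1(r,t)=Ce^{-\nu t}r$ for some constant $C$. (a) For all $f_i,g_i\in L^\infty(0,1)$ there is a linear function $h_2\in\mathcal K$, $h_2(r)=C'r$, such that the system is input-to-state stable with gain $h_2$ and rate $$\nu=\frac1\tau\ln\frac1{|q\rho(1-\epsilon)|}$$ if $q\rho(1-\epsilon)\neq0$, and with gain $h_2$ and every rate $\nu>0$ if $q\rho(1-\epsilon)=0$. The functions $h_1,h_2$ depend on the coefficients of the system (and, if $q\rho(1-\epsilon)=0$, $h_1$ also depends on $\nu$), but not on the initial data or on the inputs. (b) In particular, the same conclusion holds for the coefficients that the backstepping transformation of the observer error system produces: let $P(x,\xi)=\begin{pmatrix}P^{uu}&P^{uv}\\P^{vu}&P^{vv}\end{pmatrix}(x,\xi)$ be any bounded measurable kernel on $\{0\le x\le\xi\le1\}$, let $m_1,m_2:[0,1]\to[0,\infty)$ be continuous, let $$P^+(x)=-\lambda(1)P^{uu}(x,1)+\mu(1)\rho(1-\epsilon)P^{uv}(x,1),\qquad P^-(x)=-\lambda(1)P^{vu}(x,1)+\mu(1)\rho(1-\epsilon)P^{vv}(x,1),$$ and let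 $f_i,g_i$ be integrable solutions, for all $x\in[0,1]$, of $$\begin{pmatrix}f_i\\g_i\end{pmatrix}(x)=S_i(x)+\int_x^1P(x,\xi)\begin{pmatrix}f_i\\g_i\end{pmatrix}(\xi)\,d\xi,\qquad i=1,\dots,4,$$ with $$S_1(x)=-\begin{pmatrix}P^+(x)\\P^-(x)\end{pmatrix}-\mu(1)\rho\epsilon\begin{pmatrix}P^{uv}(x,1)\\P^{vv}(x,1)\end{pmatrix},\quad S_2=\begin{pmatrix}m_1\\0\end{pmatrix},\quad S_3=\begin{pmatrix}0\\m_2\end{pmatrix},\quad S_4(x)=\mu(1)\begin{pmatrix}P^{uv}(x,1)\\P^{vv}(x,1)\end{pmatrix}.$$ -/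

import Mathlib

open MeasureTheory Set Filter Topology
open scoped ENNReal

/-- Class `𝒦`: continuous, strictly increasing on `[0, ∞)`, and zero at zero. -/
def IsClassK (h : ℝ → ℝ) : Prop :=
  ContinuousOn h (Ici 0) ∧ StrictMonoOn h (Ici 0) ∧ h 0 = 0

/-- Class `𝒦ℒ`: of class `𝒦` in the first variable, nonincreasing to zero in the second one. -/
def IsClassKL (h : ℝ → ℝ → ℝ) : Prop :=
  (∀ t, 0 ≤ t → IsClassK fun r => h r t) ∧
    ∀ r, 0 ≤ r → AntitoneOn (h r) (Ici 0) ∧ Tendsto (h r) atTop (𝓝 0)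

/-- The time `∫₀¹ dx / v(x)` needed to cross `[0, 1]` at speed `v`. -/
noncomputable def transportTime (v : ℝ → ℝ) : ℝ := ∫ x in (0 : ℝ)..1, 1 / v x

/-- Lebesgue measure on the space interval `(0, 1)`. -/
noncomputable def spaceMeasure : Measure ℝ := volume.restrict (Ioo 0 1)

/-- The norm of `(a, b)` in `L^∞((0, 1); ℝ²)`. -/
noncomputable def stateNorm (a b : ℝ → ℝ) : ℝ :=
  (eLpNorm (fun x => (!₂[a x, b x] : EuclideanSpace ℝ (Fin 2))) ∞ spaceMeasure).toReal

/-- The norm of `(n, d₁, d₂, d₃, d₄)` in `L^∞((0, t); ℝ⁵)`; `d 0, …, d 3` stand for `d₁, …, d₄`. -/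
noncomputable def inputNorm (n : ℝ → ℝ) (d : Fin 4 → ℝ → ℝ) (t : ℝ) : ℝ :=
  (eLpNorm (fun s => (!₂[n s, d 0 s, d 1 s, d 2 s, d 3 s] : EuclideanSpace ℝ (Fin 5))) ∞
    (volume.restrict (Ioo 0 t))).toReal

/-- Measurable and essentially bounded on `(0, T)` for every `T`. -/
def IsLocallyEssBounded (w : ℝ → ℝ) : Prop :=
  ∀ T : ℝ, MemLp w ∞ (volume.restrict (Ioo 0 T))

/-- The source term `n(t) f₁(x) + d₁(t) f₂(x) + d₂(t) f₃(x) + d₄(t) f₄(x)`. -/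
def sourceTerm (n : ℝ → ℝ) (d : Fin 4 → ℝ → ℝ) (f : Fin 4 → ℝ → ℝ) (t x : ℝ) : ℝ :=
  n t * f 0 x + d 0 t * f 1 x + d 1 t * f 2 x + d 3 t * f 3 x

/-- `x : [a, b] → [0, 1]` is a characteristic of `∂ₜ + v(x) ∂ₓ`, i.e. `x'(s) = v(x(s))`. -/
def IsCharacteristic (v : ℝ → ℝ) (a b : ℝ) (x : ℝ → ℝ) : Prop :=
  ∀ s ∈ Icc a b, x s ∈ Icc (0 : ℝ) 1 ∧ HasDerivWithinAt x (v (x s)) (Icc a b) s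

/-- `y` is a broad solution of `yₜ + v(x) yₓ = K(t, x)` on `[0, ∞) × [0, 1]`: along each
characteristic, `s ↦ y(s, x(s))` is a primitive of `s ↦ K(s, x(s))`. -/
def IsBroadSolution (v : ℝ → ℝ) (K y : ℝ → ℝ → ℝ) : Prop :=
  ∀ (a b : ℝ) (x : ℝ → ℝ), 0 ≤ a → a ≤ b → IsCharacteristic v a b x →
    y b (x b) = y a (x a) + ∫ s in a..b, K s (x s)

/-- `t ↦ y(t, ·)` takes values in `L^∞(0, 1)` and is continuous from `[0, ∞)` to `L¹(0, 1)`. -/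
def IsStateTrajectory (y : ℝ → ℝ → ℝ) : Prop :=
  ∀ t, 0 ≤ t → MemLp (y t) ∞ spaceMeasure ∧
    Tendsto (fun s => eLpNorm (y s - y t) 1 spaceMeasure) (𝓝[Ici 0] t) (𝓝 0)

/-- `(α, β)` solves, for all `t ≥ 0`, the system
`αₜ + lam αₓ = n f₁ + d₁ f₂ + d₂ f₃ + d₄ f₄`, `βₜ - mu βₓ = n g₁ + d₁ g₂ + d₂ g₃ + d₄ g₄`,
`α(t, 0) = q β(t, 0) + d₃(t)`, `β(t, 1) = ρ (1 - ε) α(t, 1) + d₄(t) - ρ ε n(t)`,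
`(α, β)(0, ·) = (α₀, β₀)`. The boundary values are the limits along the characteristics. -/
structure IsObserverErrorSolution (lam mu : ℝ → ℝ) (q ρ ε : ℝ) (f g : Fin 4 → ℝ → ℝ)
    (n : ℝ → ℝ) (d : Fin 4 → ℝ → ℝ) (α₀ β₀ : ℝ → ℝ) (α β : ℝ → ℝ → ℝ) : Prop where
  trajectory_left : IsStateTrajectory α
  trajectory_right : IsStateTrajectory β
  transport_left : IsBroadSolution lam (sourceTerm n d f) α
  transport_right : IsBroadSolution (fun x => -mu x) (sourceTerm n d g) β
  boundary_zero : ∀ᵐ t ∂volume.restrict (Ioi (0 : ℝ)), α t 0 = q * β t 0 + d 2 t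
  boundary_one : ∀ᵐ t ∂volume.restrict (Ioi (0 : ℝ)),
    β t 1 = ρ * (1 - ε) * α t 1 + d 3 t - ρ * ε * n t
  initial_left : ∀ᵐ x ∂spaceMeasure, α 0 x = α₀ x
  initial_right : ∀ᵐ x ∂spaceMeasure, β 0 x = β₀ x

/-- Input-to-state stability in `L^∞` of the system above, with a linear gain `h₂` and with
`h₁ (r, t) = C e^{-ν t} r`, `ν = ln (1 / |q ρ (1 - ε)|) / τ`. If `q ρ (1 - ε) = 0`, this rate
is `∞`, and the estimate is asserted for each finite `ν > 0`, with one and the same `h₂`. -/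
def ObserverErrorISS (lam mu : ℝ → ℝ) (q ρ ε : ℝ) (f g : Fin 4 → ℝ → ℝ) : Prop :=
  ∃ h₂ : ℝ → ℝ, IsClassK h₂ ∧ (∃ C : ℝ, ∀ r, 0 ≤ r → h₂ r = C * r) ∧
    ∀ ν : ℝ, 0 < ν →
      (q * ρ * (1 - ε) ≠ 0 →
        ν = Real.log (1 / |q * ρ * (1 - ε)|) / (transportTime lam + transportTime mu)) →
      ∃ h₁ : ℝ → ℝ → ℝ, IsClassKL h₁ ∧
        (∃ C : ℝ, ∀ r t, 0 ≤ r → 0 ≤ t → h₁ r t = C * Real.exp (-(ν * t)) * r) ∧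
        ∀ (α₀ β₀ n : ℝ → ℝ) (d : Fin 4 → ℝ → ℝ),
          MemLp α₀ ∞ spaceMeasure → MemLp β₀ ∞ spaceMeasure →
          IsLocallyEssBounded n → (∀ i, IsLocallyEssBounded (d i)) →
          (∃ α β, IsObserverErrorSolution lam mu q ρ ε f g n d α₀ β₀ α β) ∧
          ∀ α β, IsObserverErrorSolution lam mu q ρ ε f g n d α₀ β₀ α β →
            ∀ t, 0 ≤ t →
              stateNorm (α t) (β t) ≤ h₂ (inputNorm n d t) + h₁ (stateNorm α₀ β₀) t

/-- The triangle `0 ≤ x ≤ ξ ≤ 1`. -/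
def kernelTriangle : Set (ℝ × ℝ) := {p | 0 ≤ p.1 ∧ p.1 ≤ p.2 ∧ p.2 ≤ 1}

/-- A bounded measurable kernel on the triangle. -/
def IsBoundedKernel (k : ℝ → ℝ → ℝ) : Prop :=
  Measurable (kernelTriangle.domRestrict (Function.uncurry k)) ∧
    ∃ M : ℝ, ∀ p ∈ kernelTriangle, |k p.1 p.2| ≤ M

/-- `(f, g)` is an integrable solution of the pair of Volterra equations
`f(x) = S(x) + ∫ₓ¹ (Puu(x, ξ) f(ξ) + Puv(x, ξ) g(ξ)) dξ`,
`g(x) = R(x) + ∫ₓ¹ (Pvu(x, ξ) f(ξ) + Pvv(x, ξ) g(ξ)) dξ`. -/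
def IsVolterraSolution (Puu Puv Pvu Pvv : ℝ → ℝ → ℝ) (S R f g : ℝ → ℝ) : Prop :=
  Integrable f spaceMeasure ∧ Integrable g spaceMeasure ∧
    ∀ x ∈ Icc (0 : ℝ) 1,
      f x = S x + (∫ ξ in x..1, (Puu x ξ * f ξ + Puv x ξ * g ξ)) ∧
      g x = R x + (∫ ξ in x..1, (Pvu x ξ * f ξ + Pvv x ξ * g ξ))

/-- The observer gain `P⁺` (for the kernels `Puu, Puv`) or `P⁻` (for `Pvu, Pvv`). -/
def observerGain (lam mu : ℝ → ℝ) (ρ ε : ℝ) (Pu Pv : ℝ → ℝ → ℝ) (x : ℝ) : ℝ :=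
  -(lam 1 * Pu x 1) + mu 1 * ρ * (1 - ε) * Pv x 1

/-- `f 0, …, f 3` and `g 0, …, g 3` are the coefficients `f₁, …, f₄`, `g₁, …, g₄` that the
backstepping transformation with kernels `Puu, Puv, Pvu, Pvv` produces in the source terms. -/
structure IsBacksteppingSource (lam mu : ℝ → ℝ) (ρ ε : ℝ) (Puu Puv Pvu Pvv : ℝ → ℝ → ℝ)
    (m₁ m₂ : ℝ → ℝ) (f g : Fin 4 → ℝ → ℝ) : Prop where
  noise : IsVolterraSolution Puu Puv Pvu Pvv
    (fun x => -observerGain lam mu ρ ε Puu Puv x - mu 1 * ρ * ε * Puv x 1)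
    (fun x => -observerGain lam mu ρ ε Pvu Pvv x - mu 1 * ρ * ε * Pvv x 1) (f 0) (g 0)
  dist_one : IsVolterraSolution Puu Puv Pvu Pvv m₁ (fun _ => 0) (f 1) (g 1)
  dist_two : IsVolterraSolution Puu Puv Pvu Pvv (fun _ => 0) m₂ (f 2) (g 2)
  dist_four : IsVolterraSolution Puu Puv Pvu Pvv
    (fun x => mu 1 * Puv x 1) (fun x => mu 1 * Pvv x 1) (f 3) (g 3)

/-! In the coordinate given by the travel time, every characteristic has unit speed, so the two
transport equations can be integrated explicitly. After the reflection `x ↦ 1 - x`, which turns the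
`β` equation into a transport with positive speed, a solution has the form α(t,x) = A(t - φ(x)) +
G₁(t, t - φ(x)), and β likewise with B, ψ and G₂. Here G₁, G₂ are the Duhamel terms `duhamel`,
bounded by a constant times the size of the inputs, and the profiles A, B are functions of one
variable: on negative arguments they carry the initial data, on nonnegative ones the inflow boundary
values (`IsTravelTime.exists_profile`, and conversely `IsTravelTime.isBroadSolution_of_profile`).

The boundary conditions then become a pair of difference equations, A(s) = q B(s - T₂) + e₁(s) and
B(s) = ρ(1 - ε) A(s - T₁) + e₂(s), whose forcing is controlled by the inputs. They are solved
forward in time (`exists_delay_solution`). One round trip lasts τ = T₁ + T₂ and multiplies the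
profiles by the loop gain k = |qρ(1 - ε)|, which the condition on ε makes smaller than one. Hence
the contribution of the data decays like e^{-νt} whenever k e^{ντ} ≤ 1, with equality at the
asserted rate, while the contributions of the inputs sum to a bounded multiple of their supremum
(`delay_decay`). The estimate is made for an arbitrary solution, so no separate uniqueness statement
is needed.

For the backstepping coefficients it suffices that an integrable solution of a Volterra equation
with bounded kernel and bounded right-hand side is itself bounded (`IsVolterraSolution.memLp_top`).
-/

/-! ### Travel time coordinates and characteristics. -/

/-- `φ` is the travel time from `0` at speed `v` and `χ` is its inverse; both are extended from
`[0, 1]`, respectively `[0, T]`, to diffeomorphisms of the real line. -/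
structure IsTravelTime (v : ℝ → ℝ) (T : ℝ) (φ χ : ℝ → ℝ) : Prop where
  left_inv : ∀ x, χ (φ x) = x
  right_inv : ∀ θ, φ (χ θ) = θ
  map_zero : φ 0 = 0
  map_one : φ 1 = T
  strictMono : StrictMono φ
  differentiable : Differentiable ℝ φ
  hasDerivAt : ∀ x ∈ Icc (0 : ℝ) 1, HasDerivAt φ (1 / v x) x
  differentiable_inv : Differentiable ℝ χ
  hasDerivAt_inv : ∀ θ ∈ Icc 0 T, HasDerivAt χ (v (χ θ)) θ

/-- Extending `v` by its endpoint values gives a continuous, positive function on the line, bounded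
above by the maximum `v x₀`. The primitive of its reciprocal therefore grows at least at the rate `1
/ v x₀`, which makes it onto, and the inverse function rule applies. -/
theorem exists_isTravelTime {v : ℝ → ℝ} (hv : ContinuousOn v (Icc 0 1))
    (hpos : ∀ x ∈ Icc (0 : ℝ) 1, 0 < v x) :
    ∃ φ χ, IsTravelTime v (transportTime v) φ χ := by
  have h01 : (0 : ℝ) ≤ 1 := zero_le_one
  set w : ℝ → ℝ := IccExtend h01 ((Icc (0 : ℝ) 1).domRestrict v) with hw
  have hwc : Continuous w := (continuousOn_iff_continuous_domRestrict.1 hv).Icc_extend'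
  have hwv : ∀ x ∈ Icc (0 : ℝ) 1, w x = v x := fun x hx => by
    rw [hw, IccExtend_of_mem _ _ hx]; rfl
  have hwpos : ∀ x, 0 < w x := fun x => hpos _ (projIcc 0 1 h01 x).2
  have hc : Continuous fun x => 1 / w x := continuous_const.div hwc fun x => (hwpos x).ne'
  obtain ⟨x₀, hx₀, hmax⟩ := isCompact_Icc.exists_isMaxOn (nonempty_Icc.2 h01) hv
  have hwle : ∀ x, w x ≤ v x₀ := fun x => hmax (projIcc 0 1 h01 x).2
  set φ : ℝ → ℝ := fun x => ∫ s in (0 : ℝ)..x, 1 / w s with hφ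
  have hder : ∀ x, HasDerivAt φ (1 / w x) x := fun x =>
    intervalIntegral.integral_hasDerivAt_right (hc.intervalIntegrable _ _)
      hc.aestronglyMeasurable.stronglyMeasurableAtFilter hc.continuousAt
  have hmono : StrictMono φ := strictMono_of_deriv_pos fun x => by
    rw [(hder x).deriv]; exact one_div_pos.2 (hwpos x)
  have hφ0 : φ 0 = 0 := by simp [hφ]
  have hgrow : Monotone fun x => φ x - x / v x₀ := by
    refine monotone_of_deriv_nonneg (fun x => ((hder x).sub
      ((hasDerivAt_id x).div_const _)).differentiableAt) fun x => ?_
    have := ((hder x).sub ((hasDerivAt_id x).div_const (v x₀))).deriv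
    change 0 ≤ deriv (φ - fun x => id x / v x₀) x
    rw [this, sub_nonneg]
    exact one_div_le_one_div_of_le (hwpos x) (hwle x)
  have hφc : Continuous φ := continuous_iff_continuousAt.2 fun x => (hder x).continuousAt
  have hsurj : Function.Surjective φ := by
    refine hφc.surjective ?_ ?_
    · refine tendsto_atTop_mono' atTop ?_ (tendsto_id.atTop_div_const (hpos _ hx₀))
      filter_upwards [eventually_ge_atTop 0] with x hx
      have := hgrow hx
      simp only [hφ0, zero_div, sub_zero] at this
      simpa using this
    · refine tendsto_atBot_mono' atBot ?_ (tendsto_id.atBot_div_const (hpos _ hx₀))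
      filter_upwards [eventually_le_atBot 0] with x hx
      have := hgrow hx
      simp only [hφ0, zero_div, sub_zero] at this
      simpa using this
  let e := hmono.orderIsoOfSurjective φ hsurj
  have hl : ∀ x, e.symm (φ x) = x := fun x => e.symm_apply_apply x
  have hr : ∀ x, φ (e.symm x) = x := fun x => e.apply_symm_apply x
  have hder' : ∀ θ, HasDerivAt e.symm (w (e.symm θ)) θ := fun θ => by
    have := HasDerivAt.of_local_left_inverse (f := φ) (g := e.symm) (a := θ)
      e.symm.continuous.continuousAt (hder _) (one_div_pos.2 (hwpos _)).ne'
      (Eventually.of_forall hr)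
    simpa using this
  have hφ1 : φ 1 = transportTime v := by
    refine intervalIntegral.integral_congr fun x hx => ?_
    rw [uIcc_of_le h01] at hx
    simp only [hwv x hx]
  refine ⟨φ, e.symm, hl, hr, hφ0, hφ1, hmono, fun x => (hder x).differentiableAt,
    fun x hx => hwv x hx ▸ hder x, fun x => (hder' x).differentiableAt, fun θ hθ => ?_⟩
  have : e.symm θ ∈ Icc (0 : ℝ) 1 := by
    rw [← hl 0, ← hl 1, hφ0, hφ1]
    exact ⟨e.symm.monotone hθ.1, e.symm.monotone hθ.2⟩
  rw [← hwv _ this]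
  exact hder' θ

/-- The preimage of a null set under `φ` lies in its image under `χ`, and differentiable maps send
null sets to null sets. -/
theorem quasiMeasurePreserving_of_differentiable_inv {φ χ : ℝ → ℝ} (hφ : Continuous φ)
    (hχ : Differentiable ℝ χ) (hl : ∀ x, χ (φ x) = x) :
    Measure.QuasiMeasurePreserving φ volume volume := by
  refine ⟨hφ.measurable, Measure.AbsolutelyContinuous.mk fun s hs h0 => ?_⟩
  rw [Measure.map_apply hφ.measurable hs]
  refine measure_mono_null (t := χ '' s) (fun x hx => ⟨φ x, hx, hl x⟩) ?_
  exact addHaar_image_eq_zero_of_differentiableOn_of_addHaar_eq_zero _ hχ.differentiableOn h0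

namespace IsTravelTime

variable {v φ χ : ℝ → ℝ} {T : ℝ}

theorem inv_zero (h : IsTravelTime v T φ χ) : χ 0 = 0 := by simpa [h.map_zero] using h.left_inv 0

theorem inv_time (h : IsTravelTime v T φ χ) : χ T = 1 := by rw [← h.map_one, h.left_inv]

theorem strictMono_inv (h : IsTravelTime v T φ χ) : StrictMono χ := fun a b hab => by
  rwa [← h.strictMono.lt_iff_lt, h.right_inv, h.right_inv]

theorem time_pos (h : IsTravelTime v T φ χ) : 0 < T := by
  rw [← h.map_zero, ← h.map_one]; exact h.strictMono one_pos

theorem mem_Icc (h : IsTravelTime v T φ χ) {x : ℝ} (hx : x ∈ Icc (0 : ℝ) 1) : φ x ∈ Icc 0 T := by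
  rw [← h.map_zero, ← h.map_one]
  exact ⟨h.strictMono.monotone hx.1, h.strictMono.monotone hx.2⟩

theorem mem_Ioo (h : IsTravelTime v T φ χ) {x : ℝ} (hx : x ∈ Ioo (0 : ℝ) 1) : φ x ∈ Ioo 0 T := by
  rw [← h.map_zero, ← h.map_one]
  exact ⟨h.strictMono hx.1, h.strictMono hx.2⟩

theorem inv_mem_Icc (h : IsTravelTime v T φ χ) {θ : ℝ} (hθ : θ ∈ Icc 0 T) :
    χ θ ∈ Icc (0 : ℝ) 1 := by
  rw [← h.inv_zero, ← h.inv_time]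
  exact ⟨h.strictMono_inv.monotone hθ.1, h.strictMono_inv.monotone hθ.2⟩

theorem inv_mem_Ioo (h : IsTravelTime v T φ χ) {θ : ℝ} (hθ : θ ∈ Ioo 0 T) :
    χ θ ∈ Ioo (0 : ℝ) 1 := by
  rw [← h.inv_zero, ← h.inv_time]
  exact ⟨h.strictMono_inv hθ.1, h.strictMono_inv hθ.2⟩

theorem quasiMeasurePreserving (h : IsTravelTime v T φ χ) :
    Measure.QuasiMeasurePreserving φ volume volume :=
  quasiMeasurePreserving_of_differentiable_inv h.differentiable.continuous h.differentiable_inv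
    h.left_inv

theorem quasiMeasurePreserving_inv (h : IsTravelTime v T φ χ) :
    Measure.QuasiMeasurePreserving χ volume volume :=
  quasiMeasurePreserving_of_differentiable_inv h.differentiable_inv.continuous h.differentiable
    h.right_inv

theorem quasiMeasurePreserving_restrict_inv (h : IsTravelTime v T φ χ) :
    Measure.QuasiMeasurePreserving χ (volume.restrict (Ioo 0 T)) spaceMeasure :=
  h.quasiMeasurePreserving_inv.restrict fun _ hθ => h.inv_mem_Ioo hθ

theorem quasiMeasurePreserving_restrict (h : IsTravelTime v T φ χ) :
    Measure.QuasiMeasurePreserving φ spaceMeasure (volume.restrict (Ioo 0 T)) :=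
  h.quasiMeasurePreserving.restrict fun _ hx => h.mem_Ioo hx

/-- Change of variables to the travel time, with a bound on the Jacobian. -/
theorem exists_lintegral_comp_le (h : IsTravelTime v T φ χ) (hv : ContinuousOn v (Icc 0 1)) :
    ∃ V : ℝ≥0∞, V ≠ ∞ ∧ ∀ F : ℝ → ℝ≥0∞,
      ∫⁻ x, F (φ x) ∂spaceMeasure ≤ V * ∫⁻ θ in Ioo 0 T, F θ := by
  obtain ⟨V, hV⟩ := isCompact_Icc.exists_bound_of_continuousOn hv
  refine ⟨ENNReal.ofReal V, ENNReal.ofReal_ne_top, fun F => ?_⟩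
  have himg : Ioo (0 : ℝ) 1 = χ '' Ioo 0 T := by
    ext x
    exact ⟨fun hx => ⟨φ x, h.mem_Ioo hx, h.left_inv x⟩, fun ⟨θ, hθ, he⟩ => he ▸ h.inv_mem_Ioo hθ⟩
  rw [spaceMeasure, himg, lintegral_image_eq_lintegral_abs_deriv_mul measurableSet_Ioo
    (fun θ hθ => (h.hasDerivAt_inv θ (Ioo_subset_Icc_self hθ)).hasDerivWithinAt)
    h.strictMono_inv.injective.injOn, ← lintegral_const_mul' _ _ ENNReal.ofReal_ne_top]
  refine setLIntegral_mono' measurableSet_Ioo fun θ hθ => ?_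
  rw [h.right_inv]
  gcongr
  exact hV _ (h.inv_mem_Icc (Ioo_subset_Icc_self hθ))

/-- Along a characteristic the travel time grows at unit rate. -/
theorem eq_add_of_isCharacteristic (h : IsTravelTime v T φ χ)
    (hpos : ∀ x ∈ Icc (0 : ℝ) 1, 0 < v x) {a b : ℝ} {x : ℝ → ℝ}
    (hx : IsCharacteristic v a b x) {s : ℝ} (hs : s ∈ Icc a b) : φ (x s) = φ (x a) + (s - a) := by
  have hd : ∀ r ∈ Icc a b, HasDerivWithinAt (fun r => φ (x r) - r) 0 (Icc a b) r := fun r hr => by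
    obtain ⟨hm, hxd⟩ := hx r hr
    have := ((h.hasDerivAt _ hm).comp_hasDerivWithinAt r hxd).sub (hasDerivWithinAt_id r _)
    rw [one_div, inv_mul_cancel₀ (hpos _ hm).ne', sub_self] at this
    exact this
  rcases (hs.1.trans hs.2).eq_or_lt with hab | hab
  · have : s = a := le_antisymm (hs.2.trans hab.ge) hs.1
    simp [this]
  have := (convex_Icc a b).is_const_of_fderivWithin_eq_zero (𝕜 := ℝ)
    (f := fun r => φ (x r) - r) (fun r hr => (hd r hr).differentiableWithinAt) (fun r hr => by
      rw [(hd r hr).hasFDerivWithinAt.fderivWithin (uniqueDiffOn_Icc hab r hr)]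
      ext; simp) hs (left_mem_Icc.2 hab.le)
  linarith

theorem isCharacteristic_shift (h : IsTravelTime v T φ χ) {a b θ : ℝ} (hθ : 0 ≤ θ)
    (hT : θ + (b - a) ≤ T) : IsCharacteristic v a b fun s => χ (θ + (s - a)) := by
  intro s hs
  have hm : θ + (s - a) ∈ Icc 0 T := ⟨by linarith [hs.1], by linarith [hs.2]⟩
  refine ⟨h.inv_mem_Icc hm, ?_⟩
  have := (h.hasDerivAt_inv _ hm).comp s
    (((hasDerivAt_id s).sub_const a).const_add θ)
  rw [mul_one] at this
  exact this.hasDerivWithinAt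

/-- Since travel time grows at unit rate, each characteristic is determined by its starting point;
this replaces a uniqueness theorem for `x' = v(x)`, and only straight lines remain to be tested. -/
theorem isBroadSolution_iff (h : IsTravelTime v T φ χ) (hpos : ∀ x ∈ Icc (0 : ℝ) 1, 0 < v x)
    {K y : ℝ → ℝ → ℝ} :
    IsBroadSolution v K y ↔ ∀ a b θ, 0 ≤ a → a ≤ b → 0 ≤ θ → θ + (b - a) ≤ T →
      y b (χ (θ + (b - a))) = y a (χ θ) + ∫ s in a..b, K s (χ (θ + (s - a))) := by
  constructor
  · intro hy a b θ ha hab hθ hT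
    simpa using hy a b _ ha hab (h.isCharacteristic_shift hθ hT)
  · intro hy a b x ha hab hx
    have hφ : ∀ s ∈ Icc a b, x s = χ (φ (x a) + (s - a)) := fun s hs => by
      rw [← h.eq_add_of_isCharacteristic hpos hx hs, h.left_inv]
    have hθ := h.mem_Icc (hx a (left_mem_Icc.2 hab)).1
    have hb := h.mem_Icc (hx b (right_mem_Icc.2 hab)).1
    rw [h.eq_add_of_isCharacteristic hpos hx (right_mem_Icc.2 hab)] at hb
    have key := hy a b (φ (x a)) ha hab hθ.1 hb.2
    rw [← hφ b (right_mem_Icc.2 hab), h.left_inv] at key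
    rw [key]
    congr 1
    refine intervalIntegral.integral_congr fun s hs => ?_
    rw [uIcc_of_le hab] at hs
    simp only [← hφ s hs]

end IsTravelTime

/-! ### Continuity of translations in L¹ and estimates of the Duhamel terms. -/

/-- Translations act continuously on `Lp` for finite exponents; the integral is the `L¹` distance to
the translate. -/
theorem MeasureTheory.Integrable.tendsto_integral_abs_sub_translate {f : ℝ → ℝ}
    (hf : Integrable f) : Tendsto (fun h => ∫ s, |f (s - h) - f s|) (𝓝 0) (𝓝 0) := by
  have hf1 : MemLp f 1 volume := memLp_one_iff_integrable.2 hf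
  set F : Lp ℝ 1 (volume : Measure ℝ) := hf1.toLp f with hF
  have : Fact ((1 : ℝ≥0∞) ≠ ∞) := ⟨ENNReal.one_ne_top⟩
  have hc : Continuous fun h : ℝ => DomAddAct.mk (-h) +ᵥ F :=
    (DomAddAct.mkHomeomorph.continuous.comp continuous_neg).vadd continuous_const
  have h0 : Tendsto (fun h : ℝ => ‖(DomAddAct.mk (-h) +ᵥ F) - F‖) (𝓝 0) (𝓝 0) := by
    have := ((hc.sub continuous_const).norm).tendsto (0 : ℝ)
      (f := fun h : ℝ => ‖(DomAddAct.mk (-h) +ᵥ F) - F‖)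
    simpa using this
  refine h0.congr fun h => ?_
  rw [hF, DomAddAct.mk_vadd_toLp, ← MemLp.toLp_sub, L1.norm_eq_integral_norm]
  refine integral_congr_ae ((MemLp.coeFn_toLp ((hf1.comp_measurePreserving
    (measurePreserving_vadd (-h) volume)).sub hf1)).mono fun s hs => ?_)
  refine (congrArg (fun z : ℝ => ‖z‖) hs).trans ?_
  simp [Real.norm_eq_abs, sub_eq_neg_add]

theorem IsLocallyEssBounded.exists_bound {w : ℝ → ℝ} (hw : IsLocallyEssBounded w) (T : ℝ) :
    ∃ W, 0 ≤ W ∧ ∀ᵐ s, s ∈ Ioo 0 T → |w s| ≤ W := by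
  refine ⟨(eLpNorm w ∞ (volume.restrict (Ioo 0 T))).toReal, ENNReal.toReal_nonneg, ?_⟩
  rw [← ae_restrict_iff' measurableSet_Ioo]
  filter_upwards [ae_le_eLpNormEssSup (f := w) (μ := volume.restrict (Ioo 0 T))] with s hs
  rw [← eLpNorm_exponent_top] at hs
  simpa using ENNReal.toReal_mono (hw T).2.ne hs

section DuhamelTerm

variable {w f : ℝ → ℝ}

theorem intervalIntegrable_duhamel (hw : IsLocallyEssBounded w) (hf : Integrable f) {a b : ℝ}
    (ha : 0 ≤ a) (hb : 0 ≤ b) (r : ℝ) :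
    IntervalIntegrable (fun s => w s * f (s - r)) volume a b := by
  have key : ∀ T, 0 ≤ T → IntervalIntegrable (fun s => w s * f (s - r)) volume 0 T := by
    intro T hT
    rw [intervalIntegrable_iff_integrableOn_Ioo_of_le hT]
    exact ((hf.comp_sub_right r).restrict (s := Ioo 0 T)).mul_of_top_right (hw T)
  exact (key a ha).symm.trans (key b hb)

theorem abs_integral_duhamel_le {a b D : ℝ} {g : ℝ → ℝ} (hab : a ≤ b) (ha : 0 ≤ a)
    (hw : ∀ᵐ s, s ∈ Ioo 0 b → |w s| ≤ D) (hg : IntervalIntegrable (fun s => |g s|) volume a b) :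
    |∫ s in a..b, w s * g s| ≤ D * ∫ s in a..b, |g s| := by
  rw [← intervalIntegral.integral_const_mul]
  refine intervalIntegral.norm_integral_le_of_norm_le (f := fun s => w s * g s) hab ?_
    (hg.const_mul D)
  filter_upwards [hw, Measure.ae_ne volume b] with s hs hne hm
  rw [norm_mul, Real.norm_eq_abs, Real.norm_eq_abs]
  exact mul_le_mul_of_nonneg_right (hs ⟨ha.trans_lt hm.1, hm.2.lt_of_ne hne⟩) (abs_nonneg _)

theorem abs_duhamel_le (hf : Integrable f) {t D : ℝ} (ht : 0 ≤ t) (hD : 0 ≤ D)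
    (hw : ∀ᵐ s, s ∈ Ioo 0 t → |w s| ≤ D) (r : ℝ) :
    |∫ s in (0 : ℝ)..t, w s * f (s - r)| ≤ D * ∫ s, |f s| := by
  have hi : Integrable fun s => |f (s - r)| := (hf.comp_sub_right r).abs
  refine (abs_integral_duhamel_le ht le_rfl hw hi.intervalIntegrable).trans ?_
  gcongr
  rw [intervalIntegral.integral_of_le ht, ← integral_sub_right_eq_self (fun s => |f s|) r]
  exact setIntegral_le_integral hi (ae_of_all _ fun s => abs_nonneg _)

/-- The input is merely bounded, so the shift has to fall on `f`: on `[0, t]` the difference costs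
the `L¹` modulus of translation of `f`, and the remaining interval `[t, t']` costs its length. Both
bounds are uniform in `θ`. -/
theorem abs_duhamel_sub_le (hw : IsLocallyEssBounded w) (hf : Integrable f) {M W N t t' : ℝ}
    (hM : ∀ᵐ s, |f s| ≤ M) (hW0 : 0 ≤ W) (hW : ∀ᵐ s, s ∈ Ioo 0 N → |w s| ≤ W)
    (ht : 0 ≤ t) (htt : t ≤ t') (ht' : t' ≤ N) (θ : ℝ) :
    |(∫ s in (0 : ℝ)..t', w s * f (s - (t' - θ))) - ∫ s in (0 : ℝ)..t, w s * f (s - (t - θ))| ≤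
      W * (M * |t' - t|) + W * ∫ s, |f (s - (t' - t)) - f s| := by
  have h0' := ht.trans htt
  have hi := fun r => hf.comp_sub_right r
  rw [← intervalIntegral.integral_add_adjacent_intervals
    (intervalIntegrable_duhamel hw hf le_rfl ht (t' - θ))
    (intervalIntegrable_duhamel hw hf ht h0' (t' - θ)), add_sub_right_comm,
    ← intervalIntegral.integral_sub (intervalIntegrable_duhamel hw hf le_rfl ht _)
    (intervalIntegrable_duhamel hw hf le_rfl ht _), add_comm (W * (M * _))]
  simp only [← mul_sub]
  refine (abs_add_le _ _).trans (add_le_add ?_ ?_)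
  · have hd : Integrable fun s => |f (s - (t' - θ)) - f (s - (t - θ))| := ((hi _).sub (hi _)).abs
    refine (abs_integral_duhamel_le ht le_rfl (hW.mono fun s hs hm =>
      hs ⟨hm.1, hm.2.trans_le (htt.trans ht')⟩) hd.intervalIntegrable).trans ?_
    gcongr
    rw [intervalIntegral.integral_of_le ht,
      ← integral_sub_right_eq_self (fun s => |f (s - (t' - t)) - f s|) (t - θ)]
    refine (setIntegral_le_integral hd (ae_of_all _ fun s => abs_nonneg _)).trans_eq ?_
    refine integral_congr_ae (ae_of_all _ fun s => ?_)
    simp only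
    congr 3; ring
  · refine (abs_integral_duhamel_le htt ht (hW.mono fun s hs hm =>
      hs ⟨hm.1, hm.2.trans_le ht'⟩) (hi _).abs.intervalIntegrable).trans ?_
    gcongr
    refine (le_abs_self _).trans (intervalIntegral.norm_integral_le_of_norm_le_const_ae
      (f := fun s => |f (s - (t' - θ))|) ?_)
    filter_upwards [(measurePreserving_sub_right volume (t' - θ)).quasiMeasurePreserving.ae hM]
      with s hs _
    simpa using hs

theorem exists_modulus_duhamel (hw : IsLocallyEssBounded w) (hf : Integrable f) {M : ℝ}
    (hM : ∀ᵐ s, |f s| ≤ M) (t₀ : ℝ) (ht₀ : 0 ≤ t₀) :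
    ∃ η : ℝ → ℝ, Tendsto η (𝓝[Ici 0] t₀) (𝓝 0) ∧ ∀ᶠ t in 𝓝[Ici 0] t₀, ∀ θ,
      |(∫ s in (0 : ℝ)..t, w s * f (s - (t - θ))) -
        ∫ s in (0 : ℝ)..t₀, w s * f (s - (t₀ - θ))| ≤ η t := by
  obtain ⟨W, hW0, hW⟩ := hw.exists_bound (t₀ + 1)
  refine ⟨fun t => W * (M * |t - t₀|) + W * ∫ s, |f (s - |t - t₀|) - f s|, ?_, ?_⟩
  · have h : Tendsto (fun t => |t - t₀|) (𝓝[Ici 0] t₀) (𝓝 0) := by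
      have : Continuous fun t => |t - t₀| := by fun_prop
      simpa using (this.tendsto t₀).mono_left nhdsWithin_le_nhds
    simpa using ((h.const_mul M).const_mul W).add
      ((hf.tendsto_integral_abs_sub_translate.comp h).const_mul W)
  · filter_upwards [self_mem_nhdsWithin, mem_nhdsWithin_of_mem_nhds (Iio_mem_nhds (lt_add_one t₀))]
      with t ht ht1 θ
    rcases le_total t₀ t with h | h
    · refine (abs_duhamel_sub_le hw hf hM hW0 hW ht₀ h ht1.le θ).trans_eq ?_
      rw [abs_of_nonneg (sub_nonneg.2 h)]
    · rw [abs_sub_comm, abs_sub_comm t t₀]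
      refine (abs_duhamel_sub_le hw hf hM hW0 hW ht h (lt_add_one _).le θ).trans_eq ?_
      rw [abs_of_nonneg (sub_nonneg.2 h)]

end DuhamelTerm

/-- The contribution of the sources `w i (s) f i (θ)` to the transport equation at unit speed, on the
characteristic `θ = s - r` up to the time `t`. -/
noncomputable def duhamel (w f : Fin 4 → ℝ → ℝ) (t r : ℝ) : ℝ :=
  ∑ i, ∫ s in (0 : ℝ)..t, w i s * f i (s - r)

section Duhamel

variable {w f : Fin 4 → ℝ → ℝ}

theorem abs_duhamel_sum_le (hf : ∀ i, Integrable (f i)) {t D : ℝ} (ht : 0 ≤ t) (hD : 0 ≤ D)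
    (hw : ∀ i, ∀ᵐ s, s ∈ Ioo 0 t → |w i s| ≤ D) (r : ℝ) :
    |duhamel w f t r| ≤ (∑ i, ∫ s, |f i s|) * D := by
  rw [mul_comm, Finset.mul_sum]
  exact (Finset.abs_sum_le_sum_abs _ _).trans
    (Finset.sum_le_sum fun i _ => abs_duhamel_le (hf i) ht hD (hw i) r)

theorem exists_modulus_duhamel_sum (hw : ∀ i, IsLocallyEssBounded (w i))
    (hf : ∀ i, Integrable (f i)) (hM : ∀ i, ∃ M, ∀ᵐ s, |f i s| ≤ M) (t₀ : ℝ) (ht₀ : 0 ≤ t₀) :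
    ∃ η : ℝ → ℝ, Tendsto η (𝓝[Ici 0] t₀) (𝓝 0) ∧ ∀ᶠ t in 𝓝[Ici 0] t₀, ∀ θ,
      |duhamel w f t (t - θ) - duhamel w f t₀ (t₀ - θ)| ≤ η t := by
  choose M hM using hM
  choose η hη hle using fun i => exists_modulus_duhamel (hw i) (hf i) (hM i) t₀ ht₀
  refine ⟨fun t => ∑ i, η i t, by simpa using tendsto_finsetSum _ fun i _ => hη i, ?_⟩
  filter_upwards [eventually_all.2 hle] with t ht θ
  rw [duhamel, duhamel, ← Finset.sum_sub_distrib]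
  exact (Finset.abs_sum_le_sum_abs _ _).trans (Finset.sum_le_sum fun i _ => ht i θ)

theorem continuousOn_duhamel (hw : ∀ i, IsLocallyEssBounded (w i))
    (hf : ∀ i, Integrable (f i)) (hM : ∀ i, ∃ M, ∀ᵐ s, |f i s| ≤ M) (θ : ℝ) :
    ContinuousOn (fun t => duhamel w f t (t - θ)) (Ici 0) := by
  intro t₀ ht₀
  obtain ⟨η, hη, hle⟩ := exists_modulus_duhamel_sum hw hf hM t₀ ht₀
  refine tendsto_iff_dist_tendsto_zero.2 (squeeze_zero' (Eventually.of_forall fun _ =>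
    dist_nonneg) ?_ hη)
  filter_upwards [hle] with t ht using ht θ

/-- Provides the measurability in space of the Duhamel term at a fixed time. -/
theorem continuous_duhamel_right (hw : ∀ i, IsLocallyEssBounded (w i))
    (hf : ∀ i, Integrable (f i)) {t : ℝ} (ht : 0 ≤ t) : Continuous (duhamel w f t) := by
  refine continuous_finsetSum _ fun i _ => continuous_iff_continuousAt.2 fun r₀ => ?_
  obtain ⟨W, hW0, hW⟩ := (hw i).exists_bound t
  have hi := fun r => (hf i).comp_sub_right r
  have h : Tendsto (fun r => r - r₀) (𝓝 r₀) (𝓝 0) := by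
    have : Continuous fun r => r - r₀ := by fun_prop
    simpa using this.tendsto r₀
  refine tendsto_iff_dist_tendsto_zero.2 (squeeze_zero (fun _ => dist_nonneg) (fun r => ?_)
    (by simpa using ((hf i).tendsto_integral_abs_sub_translate.comp h).const_mul W))
  have hd : Integrable fun s => |f i (s - r) - f i (s - r₀)| := ((hi _).sub (hi _)).abs
  rw [Real.dist_eq, ← intervalIntegral.integral_sub
    (intervalIntegrable_duhamel (hw i) (hf i) le_rfl ht _)
    (intervalIntegrable_duhamel (hw i) (hf i) le_rfl ht _)]
  simp only [← mul_sub]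
  refine (abs_integral_duhamel_le ht le_rfl hW hd.intervalIntegrable).trans ?_
  gcongr
  rw [intervalIntegral.integral_of_le ht,
    ← integral_sub_right_eq_self (fun s => |f i (s - (r - r₀)) - f i s|) r₀]
  refine (setIntegral_le_integral hd (ae_of_all _ fun s => abs_nonneg _)).trans_eq ?_
  refine integral_congr_ae (ae_of_all _ fun s => ?_)
  simp only
  congr 3; ring

end Duhamel

/-! ### Bounded coefficients in travel time and the profile of a broad solution. -/

instance : IsFiniteMeasure spaceMeasure := by
  unfold spaceMeasure; infer_instance

theorem memLp_top_iff_exists_bound {α : Type*} {m : MeasurableSpace α} {μ : Measure α}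
    {f : α → ℝ} :
    MemLp f ∞ μ ↔ AEStronglyMeasurable f μ ∧ ∃ C : ℝ, ∀ᵐ x ∂μ, |f x| ≤ C := by
  refine ⟨fun h => ⟨h.1, (eLpNorm f ∞ μ).toReal, ?_⟩, fun ⟨h, C, hC⟩ => memLp_top_of_bound h C hC⟩
  filter_upwards [ae_le_eLpNormEssSup (f := f) (μ := μ)] with s hs
  rw [← eLpNorm_exponent_top] at hs
  simpa using ENNReal.toReal_mono h.2.ne hs

theorem MeasureTheory.MemLp.top_comp_quasiMeasurePreserving {α β : Type*} {m : MeasurableSpace α}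
    {m' : MeasurableSpace β} {μ : Measure α} {ν : Measure β} {f : β → ℝ} {g : α → β}
    (hf : MemLp f ∞ ν) (hg : Measure.QuasiMeasurePreserving g μ ν) :
    MemLp (fun x => f (g x)) ∞ μ := by
  obtain ⟨h, C, hC⟩ := memLp_top_iff_exists_bound.1 hf
  exact memLp_top_iff_exists_bound.2
    ⟨h.comp_quasiMeasurePreserving hg, C, hg.ae hC⟩

theorem quasiMeasurePreserving_restrict_sub_left {a b c d t : ℝ} (hac : t - b ≥ c)
    (hbd : t - a ≤ d) : Measure.QuasiMeasurePreserving (fun θ => t - θ)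
      (volume.restrict (Ioo a b)) (volume.restrict (Ioo c d)) :=
  (Measure.measurePreserving_sub_left volume t).quasiMeasurePreserving.restrict
    fun θ hθ => ⟨by linarith [hθ.2], by linarith [hθ.1]⟩

/-- The coefficient `f` in the travel time coordinate, extended by zero. -/
noncomputable def travelCoeff (χ : ℝ → ℝ) (T : ℝ) (f : ℝ → ℝ) : ℝ → ℝ :=
  (Icc 0 T).indicator fun θ => f (χ θ)

theorem travelCoeff_of_mem {χ f : ℝ → ℝ} {T θ : ℝ} (hθ : θ ∈ Icc 0 T) :
    travelCoeff χ T f θ = f (χ θ) := indicator_of_mem hθ _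

theorem travelCoeff_of_neg {χ f : ℝ → ℝ} {T θ : ℝ} (hθ : θ < 0) : travelCoeff χ T f θ = 0 :=
  indicator_of_notMem (fun h => hθ.not_ge h.1) _

/-- For `s < t` the argument `s - t` is negative, where the coefficients vanish. Hence the sources
contribute nothing at the inflow end. -/
theorem duhamel_self {w f : Fin 4 → ℝ → ℝ} (hf : ∀ i, ∀ θ < 0, f i θ = 0) {t : ℝ} (ht : 0 ≤ t) :
    duhamel w f t t = 0 := by
  refine Finset.sum_eq_zero fun i _ => intervalIntegral.integral_zero_ae ?_
  filter_upwards [Measure.ae_ne volume t] with s hs hm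
  rw [uIoc_of_le ht] at hm
  rw [hf i _ (sub_neg.2 (hm.2.lt_of_ne hs)), mul_zero]

theorem duhamel_zero (w f : Fin 4 → ℝ → ℝ) (r : ℝ) : duhamel w f 0 r = 0 := by
  simp [duhamel]

namespace IsTravelTime

variable {v φ χ : ℝ → ℝ} {T : ℝ}

theorem memLp_travelCoeff (h : IsTravelTime v T φ χ) {f : ℝ → ℝ} (hf : MemLp f ∞ spaceMeasure) :
    MemLp (travelCoeff χ T f) ∞ volume := by
  rw [travelCoeff, memLp_indicator_iff_restrict measurableSet_Icc,
    Measure.restrict_congr_set Ioo_ae_eq_Icc.symm]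
  exact MemLp.top_comp_quasiMeasurePreserving hf h.quasiMeasurePreserving_restrict_inv

theorem integrable_travelCoeff (h : IsTravelTime v T φ χ) {f : ℝ → ℝ}
    (hf : MemLp f ∞ spaceMeasure) : Integrable (travelCoeff χ T f) := by
  rw [travelCoeff, integrable_indicator_iff measurableSet_Icc, IntegrableOn,
    Measure.restrict_congr_set Ioo_ae_eq_Icc.symm]
  exact (MemLp.top_comp_quasiMeasurePreserving hf h.quasiMeasurePreserving_restrict_inv).integrable
    le_top

theorem exists_bound_travelCoeff (h : IsTravelTime v T φ χ) {f : ℝ → ℝ}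
    (hf : MemLp f ∞ spaceMeasure) : ∃ M, ∀ᵐ s, |travelCoeff χ T f s| ≤ M :=
  (memLp_top_iff_exists_bound.1 (h.memLp_travelCoeff hf)).2

variable {w f : Fin 4 → ℝ → ℝ}

theorem integral_eq_duhamel_sub (h : IsTravelTime v T φ χ)
    (hw : ∀ i, IsLocallyEssBounded (w i)) (hf : ∀ i, MemLp (f i) ∞ spaceMeasure) {a b θ : ℝ}
    (ha : 0 ≤ a) (hab : a ≤ b) (hθ : 0 ≤ θ) (hT : θ + (b - a) ≤ T) :
    ∫ s in a..b, ∑ i, w i s * f i (χ (θ + (s - a))) =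
      duhamel w (fun i => travelCoeff χ T (f i)) b (a - θ) -
        duhamel w (fun i => travelCoeff χ T (f i)) a (a - θ) := by
  have hi := fun i {c d : ℝ} (hc : 0 ≤ c) (hd : 0 ≤ d) =>
    intervalIntegrable_duhamel (hw i) (h.integrable_travelCoeff (hf i)) hc hd (a - θ)
  have hb := ha.trans hab
  rw [duhamel, duhamel, ← Finset.sum_sub_distrib]
  rw [intervalIntegral.integral_congr
    (g := fun s => ∑ i, w i s * travelCoeff χ T (f i) (s - (a - θ))),
    intervalIntegral.integral_finsetSum fun i _ => hi i ha hb]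
  · exact Finset.sum_congr rfl fun i _ =>
      (intervalIntegral.integral_interval_sub_left (hi i le_rfl hb) (hi i le_rfl ha)).symm
  · intro s hs
    rw [uIcc_of_le hab] at hs
    have he : s - (a - θ) = θ + (s - a) := by ring
    refine Finset.sum_congr rfl fun i _ => ?_
    rw [he, travelCoeff_of_mem ⟨by linarith [hs.1], by linarith [hs.2]⟩]

/-- Traced backwards, a characteristic leaves the domain either through the inflow boundary at time
`t - φ x`, or through the initial line at travel time `φ x - t`. The foot depends only on `t - φ x`.
-/
theorem exists_profile (h : IsTravelTime v T φ χ) (hpos : ∀ x ∈ Icc (0 : ℝ) 1, 0 < v x)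
    (hw : ∀ i, IsLocallyEssBounded (w i)) (hf : ∀ i, MemLp (f i) ∞ spaceMeasure)
    {y : ℝ → ℝ → ℝ} (hy : IsBroadSolution v (fun t x => ∑ i, w i t * f i x) y) :
    ∃ A : ℝ → ℝ, ∀ t x, 0 ≤ t → x ∈ Icc (0 : ℝ) 1 →
      y t x = A (t - φ x) + duhamel w (fun i => travelCoeff χ T (f i)) t (t - φ x) := by
  rw [h.isBroadSolution_iff hpos] at hy
  -- The two truncations describe both kinds of foot at once: `(r, 0)` if `r ≥ 0`, and time zero at
  -- travel time `-r` if `r ≤ 0`.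
  refine ⟨fun r => y (max r 0) (χ (max (-r) 0)), fun t x ht hx => ?_⟩
  have hθ := h.mem_Icc hx
  rcases le_total 0 (t - φ x) with hr | hr
  · have hT : 0 + (t - (t - φ x)) ≤ T := by linarith [hθ.2]
    have hle : t - φ x ≤ t := by linarith [hθ.1]
    have := hy (t - φ x) t 0 hr hle le_rfl hT
    rw [h.integral_eq_duhamel_sub hw hf hr hle le_rfl hT] at this
    simp only [sub_zero, zero_add, sub_sub_cancel, h.left_inv] at this
    rw [duhamel_self (fun i θ hθ => travelCoeff_of_neg hθ) hr, sub_zero] at this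
    simp only
    rw [this, max_eq_left hr, max_eq_right (neg_nonpos.2 hr)]
  · have hT : (φ x - t) + (t - 0) ≤ T := by linarith [hθ.2]
    have hx0 : 0 ≤ φ x - t := by linarith
    have := hy 0 t (φ x - t) le_rfl ht hx0 hT
    rw [h.integral_eq_duhamel_sub hw hf le_rfl ht hx0 hT] at this
    simp only [sub_zero, sub_add_cancel, zero_sub, neg_sub, h.left_inv, duhamel_zero] at this
    simp only
    rw [this, max_eq_right hr, neg_sub, max_eq_left hx0]

theorem isBroadSolution_of_profile (h : IsTravelTime v T φ χ)
    (hpos : ∀ x ∈ Icc (0 : ℝ) 1, 0 < v x) (hw : ∀ i, IsLocallyEssBounded (w i))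
    (hf : ∀ i, MemLp (f i) ∞ spaceMeasure) (A : ℝ → ℝ) :
    IsBroadSolution v (fun t x => ∑ i, w i t * f i x) fun t x =>
      A (t - φ x) + duhamel w (fun i => travelCoeff χ T (f i)) t (t - φ x) := by
  rw [h.isBroadSolution_iff hpos]
  intro a b θ ha hab hθ hT
  rw [h.integral_eq_duhamel_sub hw hf ha hab hθ hT, h.right_inv, h.right_inv]
  have : b - (θ + (b - a)) = a - θ := by ring
  rw [this]
  ring

theorem quasiMeasurePreserving_sub (h : IsTravelTime v T φ χ) {t N : ℝ} (ht : 0 ≤ t)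
    (hN : t ≤ N) :
    Measure.QuasiMeasurePreserving (fun x => t - φ x) spaceMeasure
      (volume.restrict (Ioo (-T) N)) :=
  (quasiMeasurePreserving_restrict_sub_left (by linarith) (by linarith)).comp
    h.quasiMeasurePreserving_restrict

theorem tendsto_eLpNorm_translate (h : IsTravelTime v T φ χ) (hv : ContinuousOn v (Icc 0 1))
    {A : ℝ → ℝ} (hA : ∀ t, MemLp A ∞ (volume.restrict (Ioo (-T) t))) {t₀ : ℝ} (ht₀ : 0 ≤ t₀) :
    Tendsto (fun t => eLpNorm (fun x => A (t - φ x) - A (t₀ - φ x)) 1 spaceMeasure)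
      (𝓝[Ici 0] t₀) (𝓝 0) := by
  obtain ⟨V, hV, hle⟩ := h.exists_lintegral_comp_le hv
  -- The profile is controlled only on bounded time intervals. Cutting it off at `t₀ + 1` makes it
  -- integrable on the line and changes nothing for times `t < t₀ + 1`.
  set Ā : ℝ → ℝ := (Ioo (-T) (t₀ + 1)).indicator A with hĀ
  have hint : Integrable Ā := by
    rw [hĀ, integrable_indicator_iff measurableSet_Ioo]
    exact (hA (t₀ + 1)).integrable le_top
  have hlim : Tendsto (fun t => V * ENNReal.ofReal (∫ s, |Ā (s - (t₀ - t)) - Ā s|))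
      (𝓝[Ici 0] t₀) (𝓝 0) := by
    have h1 : Tendsto (fun t => t₀ - t) (𝓝[Ici 0] t₀) (𝓝 0) := by
      have : Continuous fun t => t₀ - t := by fun_prop
      simpa using (this.tendsto t₀).mono_left nhdsWithin_le_nhds
    simpa using ENNReal.Tendsto.const_mul
      (ENNReal.tendsto_ofReal (hint.tendsto_integral_abs_sub_translate.comp h1)) (Or.inr hV)
  refine tendsto_of_tendsto_of_tendsto_of_le_of_le' tendsto_const_nhds hlim
    (Eventually.of_forall fun _ => zero_le) ?_
  filter_upwards [self_mem_nhdsWithin, mem_nhdsWithin_of_mem_nhds (Iio_mem_nhds (lt_add_one t₀))]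
    with t ht ht1
  rw [eLpNorm_one_eq_lintegral_enorm]
  refine (hle fun θ => ‖A (t - θ) - A (t₀ - θ)‖ₑ).trans ?_
  gcongr
  have hm : ∀ s, s ∈ Ici (0 : ℝ) → s < t₀ + 1 → ∀ θ ∈ Ioo 0 T, A (s - θ) = Ā (s - θ) :=
    fun s hs hs1 θ hθ => by
      rw [hĀ, indicator_of_mem]
      have : 0 ≤ s := hs
      exact ⟨by linarith [hθ.2], by linarith [hθ.1]⟩
  have hii : Integrable fun s => Ā (s - (t₀ - t)) - Ā s := (hint.comp_sub_right _).sub hint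
  calc ∫⁻ θ in Ioo 0 T, ‖A (t - θ) - A (t₀ - θ)‖ₑ
      = ∫⁻ θ in Ioo 0 T, ‖Ā (t - θ) - Ā (t₀ - θ)‖ₑ :=
        setLIntegral_congr_fun measurableSet_Ioo fun θ hθ => by
          simp only [hm t ht ht1 θ hθ, hm t₀ ht₀ (lt_add_one _) θ hθ]
    _ ≤ ∫⁻ θ, ‖Ā (t - θ) - Ā (t₀ - θ)‖ₑ := setLIntegral_le_lintegral _ _
    _ = ∫⁻ s, ‖Ā (s - (t₀ - t)) - Ā s‖ₑ := by
        rw [← lintegral_sub_left_eq_self (fun s => ‖Ā (s - (t₀ - t)) - Ā s‖ₑ) t₀]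
        refine lintegral_congr fun θ => ?_
        congr 3; ring
    _ = ENNReal.ofReal (∫ s, |Ā (s - (t₀ - t)) - Ā s|) :=
        (ofReal_integral_norm_eq_lintegral_enorm hii).symm

/-- The profile moves by translation, which is continuous in `L¹`, and the Duhamel term is
continuous in time even uniformly in space. -/
theorem isStateTrajectory_of_profile (h : IsTravelTime v T φ χ) (hv : ContinuousOn v (Icc 0 1))
    (hw : ∀ i, IsLocallyEssBounded (w i)) (hf : ∀ i, MemLp (f i) ∞ spaceMeasure) {A : ℝ → ℝ}
    (hA : ∀ t, MemLp A ∞ (volume.restrict (Ioo (-T) t))) :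
    IsStateTrajectory fun t x =>
      A (t - φ x) + duhamel w (fun i => travelCoeff χ T (f i)) t (t - φ x) := by
  have hfi := fun i => h.integrable_travelCoeff (hf i)
  have hfM := fun i => h.exists_bound_travelCoeff (hf i)
  have hAt : ∀ t, 0 ≤ t → MemLp (fun x => A (t - φ x)) ∞ spaceMeasure := fun t ht =>
    MemLp.top_comp_quasiMeasurePreserving (hA t) (h.quasiMeasurePreserving_sub ht le_rfl)
  have hG : ∀ t, 0 ≤ t → MemLp (fun x => duhamel w (fun i => travelCoeff χ T (f i)) t (t - φ x)) ∞
      spaceMeasure := fun t ht => by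
    choose W hW0 hW using fun i => (hw i).exists_bound t
    refine memLp_top_iff_exists_bound.2 ⟨((continuous_duhamel_right hw hfi ht).comp
      (continuous_const.sub h.differentiable.continuous)).aestronglyMeasurable, _,
      ae_of_all _ fun x => abs_duhamel_sum_le hfi ht (Finset.sum_nonneg fun i _ => hW0 i)
        (fun i => (hW i).mono fun s hs hm => (hs hm).trans
          (Finset.single_le_sum (fun j _ => hW0 j) (Finset.mem_univ i))) _⟩
  intro t₀ ht₀
  refine ⟨(hAt t₀ ht₀).add (hG t₀ ht₀), ?_⟩
  obtain ⟨η, hη, hle⟩ := exists_modulus_duhamel_sum hw hfi hfM t₀ ht₀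
  have hlim := (h.tendsto_eLpNorm_translate hv hA ht₀).add (ENNReal.Tendsto.const_mul
    (ENNReal.tendsto_ofReal hη) (Or.inr (measure_ne_top spaceMeasure univ)))
  simp only [ENNReal.ofReal_zero, mul_zero, add_zero] at hlim
  refine tendsto_of_tendsto_of_tendsto_of_le_of_le' tendsto_const_nhds hlim
    (Eventually.of_forall fun _ => zero_le) ?_
  filter_upwards [self_mem_nhdsWithin, hle] with t ht hη
  have hbd := eLpNorm_le_of_ae_bound (p := 1) (μ := spaceMeasure) (C := η t)
    (f := fun x => duhamel w (fun i => travelCoeff χ T (f i)) t (t - φ x) -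
      duhamel w (fun i => travelCoeff χ T (f i)) t₀ (t₀ - φ x)) (ae_of_all _ fun x => hη (φ x))
  rw [ENNReal.toReal_one, inv_one, ENNReal.rpow_one] at hbd
  refine le_trans (le_of_eq ?_) ((eLpNorm_add_le ((hAt t ht).sub (hAt t₀ ht₀)).1
    ((hG t ht).sub (hG t₀ ht₀)).1 le_rfl).trans (add_le_add le_rfl hbd))
  congr 1
  ext x
  simp only [Pi.sub_apply, Pi.add_apply]
  ring

end IsTravelTime

/-! ### Difference equations with two delays. -/

theorem memLp_extend_past {a c : ℝ → ℝ} {T t : ℝ}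
    (ha : MemLp a ∞ (volume.restrict (Ioo (-T) 0))) (hc : MemLp c ∞ (volume.restrict (Ioo 0 t))) :
    MemLp (fun s => if s < 0 then a s else c s) ∞ (volume.restrict (Ioo (-T) t)) := by
  refine MemLp.piecewise (s := Iio 0) (f := a) (g := c) measurableSet_Iio ?_ ?_
  · rw [Measure.restrict_restrict measurableSet_Iio]
    exact ha.mono_measure (Measure.restrict_mono_set _ (show Iio 0 ∩ Ioo (-T) t ⊆ Ioo (-T) 0 from
      fun s hs => ⟨hs.2.1, hs.1⟩))
  · rw [Measure.restrict_restrict measurableSet_Iio.compl]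
    rw [Measure.restrict_congr_set Ioo_ae_eq_Ico] at hc
    exact hc.mono_measure (Measure.restrict_mono_set _ (show (Iio 0)ᶜ ∩ Ioo (-T) t ⊆ Ico 0 t from
      fun s hs => ⟨not_lt.1 hs.1, hs.2.2⟩))

theorem MeasureTheory.MemLp.comp_delay {b : ℝ → ℝ} {T t : ℝ} (hT : 0 < T)
    (hb : MemLp b ∞ (volume.restrict (Ioo (-T) t))) :
    MemLp (fun s => b (s - T)) ∞ (volume.restrict (Ioo 0 t)) :=
  MemLp.top_comp_quasiMeasurePreserving hb
    ((measurePreserving_sub_right volume T).quasiMeasurePreserving.restrict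
      fun s hs => ⟨by linarith [hs.1], by linarith [hs.2]⟩)

/-- Existence for a pair of linear difference equations with two delays. -/
theorem exists_delay_solution {T₁ T₂ : ℝ} (q p : ℝ) {a b e₁ e₂ : ℝ → ℝ} (hT₁ : 0 < T₁)
    (hT₂ : 0 < T₂) (ha : MemLp a ∞ (volume.restrict (Ioo (-T₁) 0)))
    (hb : MemLp b ∞ (volume.restrict (Ioo (-T₂) 0)))
    (he₁ : ∀ t, MemLp e₁ ∞ (volume.restrict (Ioo 0 t)))
    (he₂ : ∀ t, MemLp e₂ ∞ (volume.restrict (Ioo 0 t))) :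
    ∃ A B : ℝ → ℝ, (∀ t, MemLp A ∞ (volume.restrict (Ioo (-T₁) t))) ∧
      (∀ t, MemLp B ∞ (volume.restrict (Ioo (-T₂) t))) ∧
      (∀ s < 0, A s = a s ∧ B s = b s) ∧
      ∀ s, 0 ≤ s → A s = q * B (s - T₂) + e₁ s ∧ B s = p * A (s - T₁) + e₂ s := by
  let step : (ℝ → ℝ) × (ℝ → ℝ) → (ℝ → ℝ) × (ℝ → ℝ) := fun X =>
    (fun s => if s < 0 then a s else q * X.2 (s - T₂) + e₁ s,
      fun s => if s < 0 then b s else p * X.1 (s - T₁) + e₂ s)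
  let X : ℕ → (ℝ → ℝ) × (ℝ → ℝ) := fun n =>
    step^[n] (fun s => if s < 0 then a s else 0, fun s => if s < 0 then b s else 0)
  have hXs : ∀ n, X (n + 1) = step (X n) := fun n => Function.iterate_succ_apply' _ _ _
  have hmem : ∀ n, (∀ t, MemLp (X n).1 ∞ (volume.restrict (Ioo (-T₁) t))) ∧
      ∀ t, MemLp (X n).2 ∞ (volume.restrict (Ioo (-T₂) t)) := by
    intro n
    induction n with
    | zero => exact ⟨fun t => memLp_extend_past ha MemLp.zero', fun t =>
        memLp_extend_past hb MemLp.zero'⟩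
    | succ n ih =>
      rw [hXs]
      exact ⟨fun t => memLp_extend_past ha ((((ih.2 t).comp_delay hT₂).const_mul q).add (he₁ t)),
        fun t => memLp_extend_past hb ((((ih.1 t).comp_delay hT₁).const_mul p).add (he₂ t))⟩
  -- Each iteration settles the values on a further interval of length `δ`, since both equations
  -- look back at least that far.
  set δ := min T₁ T₂ with hδ
  have hδ0 : 0 < δ := lt_min hT₁ hT₂
  have hδ₁ : δ ≤ T₁ := min_le_left _ _
  have hδ₂ : δ ≤ T₂ := min_le_right _ _
  have hstep : ∀ n : ℕ, ∀ s < n * δ, (X (n + 1)).1 s = (X n).1 s ∧ (X (n + 1)).2 s = (X n).2 s := by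
    intro n
    induction n with
    | zero =>
      intro s hs
      have hs0 : s < 0 := by simpa using hs
      simp [X, step, hs0]
    | succ n ih =>
      intro s hs
      push_cast at hs
      rw [hXs (n + 1), hXs n]
      rw [hXs n] at ih
      simp only [step] at ih ⊢
      constructor
      · rw [(ih (s - T₂) (by linarith)).2]
      · rw [(ih (s - T₁) (by linarith)).1]
  have hstab : ∀ n m : ℕ, n ≤ m → ∀ s < n * δ, (X m).1 s = (X n).1 s ∧ (X m).2 s = (X n).2 s := by
    intro n m hnm
    induction m, hnm using Nat.le_induction with
    | base => exact fun s _ => ⟨rfl, rfl⟩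
    | succ m hm ih =>
      intro s hs
      have hs' : s < m * δ := hs.trans_le (by gcongr)
      exact ⟨(hstep m s hs').1.trans (ih s hs).1, (hstep m s hs').2.trans (ih s hs).2⟩
  -- After `N s` iterations the value at `s` no longer changes, so evaluating iterate `N s` at `s`
  -- gives the limit.
  let N : ℝ → ℕ := fun s => ⌊s / δ⌋₊ + 1
  have hN : ∀ s, s < N s * δ := fun s => by
    rw [← div_lt_iff₀ hδ0]; exact_mod_cast Nat.lt_floor_add_one _
  have hlim : ∀ (n : ℕ), ∀ s < n * δ, (X (N s)).1 s = (X n).1 s ∧ (X (N s)).2 s = (X n).2 s := by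
    intro n s hs
    rcases le_total n (N s) with h | h
    · exact hstab n _ h s hs
    · exact ⟨((hstab _ n h s (hN s)).1).symm, ((hstab _ n h s (hN s)).2).symm⟩
  refine ⟨fun s => (X (N s)).1 s, fun s => (X (N s)).2 s, fun t => ?_, fun t => ?_, fun s hs => ?_,
    fun s hs => ?_⟩
  · refine ((hmem (N t)).1 t).ae_eq ?_
    filter_upwards [ae_restrict_mem measurableSet_Ioo] with s hs
    exact (hlim _ s (hs.2.trans (hN t))).1.symm
  · refine ((hmem (N t)).2 t).ae_eq ?_
    filter_upwards [ae_restrict_mem measurableSet_Ioo] with s hs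
    exact (hlim _ s (hs.2.trans (hN t))).2.symm
  · have := hlim 0 s (by simpa using hs)
    simpa [X, hs] using this
  · have h := hlim (N s + 1) s ((hN s).trans (by push_cast; linarith))
    simp only [h.1, h.2, hXs]
    have h₁ := (hlim (N s) (s - T₁) (by linarith [hN s])).1
    have h₂ := (hlim (N s) (s - T₂) (by linarith [hN s])).2
    rw [h₁, h₂]
    simp [step, hs.not_gt]

/-- Half a round trip: a bound for `B` below `N` passes to `A` below `N + T₂`, the delay costing the
factor `exp (ν T₂)`. On the past, the initial bound suffices because the exponential is at least one
there. -/
theorem delay_decay_step {A B : ℝ → ℝ} {T₁ T₂ N t q c a b C C' R D ν : ℝ} (hν : 0 ≤ ν)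
    (hq : 0 ≤ q) (hR : 0 ≤ R) (hD : 0 ≤ D) (ha : 1 ≤ a) (hC0 : 0 ≤ C)
    (hA : ∀ᵐ s, s ∈ Ioo (-T₁) 0 → |A s| ≤ R)
    (hrec : ∀ᵐ s, s ∈ Ioo 0 t → |A s| ≤ q * |B (s - T₂)| + c * D)
    (hB : ∀ᵐ s, s ∈ Ioo (-T₂) N → |B s| ≤ b * Real.exp (-(ν * s)) * R + C' * D)
    (hab : q * Real.exp (ν * T₂) * b ≤ a) (hC : q * C' + c ≤ C) :
    ∀ᵐ s, s ∈ Ioo (-T₁) t → s - T₂ < N → |A s| ≤ a * Real.exp (-(ν * s)) * R + C * D := by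
  filter_upwards [hA, hrec, Measure.ae_ne volume 0,
    (measurePreserving_sub_right volume T₂).quasiMeasurePreserving.ae hB] with s h1 h2 h3 h4 hs hN
  rcases lt_or_gt_of_ne h3 with h0 | h0
  · have he : 1 ≤ Real.exp (-(ν * s)) := Real.one_le_exp (by nlinarith)
    have : 1 * R ≤ a * Real.exp (-(ν * s)) * R := by
      gcongr; exact one_le_mul_of_one_le_of_one_le ha he
    nlinarith [h1 ⟨hs.1, h0⟩, mul_nonneg hC0 hD]
  · have hb := h4 ⟨by linarith, hN⟩
    have hexp : Real.exp (-(ν * (s - T₂))) = Real.exp (ν * T₂) * Real.exp (-(ν * s)) := by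
      rw [← Real.exp_add]; ring_nf
    calc |A s| ≤ q * (b * Real.exp (-(ν * (s - T₂))) * R + C' * D) + c * D :=
          (h2 ⟨h0, hs.2⟩).trans (by gcongr)
      _ = (q * Real.exp (ν * T₂) * b) * Real.exp (-(ν * s)) * R + (q * C' + c) * D := by
          rw [hexp]; ring
      _ ≤ _ := by gcongr

/-- Exponential decay, up to the size of the inputs, for a pair of difference equations with two
delays whose loop gain is less than one. -/
theorem delay_decay {T₁ T₂ q p c : ℝ} (hT₁ : 0 < T₁) (hT₂ : 0 < T₂) (hq : 0 ≤ q) (hp : 0 ≤ p)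
    (hqp : q * p < 1) (hc : 0 ≤ c) :
    ∃ C', 0 ≤ C' ∧ ∀ ν, 0 ≤ ν → q * p * Real.exp (ν * (T₁ + T₂)) ≤ 1 → ∃ C, 0 ≤ C ∧
      ∀ (A B : ℝ → ℝ) (t R D : ℝ), 0 ≤ t → 0 ≤ R → 0 ≤ D →
        (∀ᵐ s, s ∈ Ioo (-T₁) 0 → |A s| ≤ R) → (∀ᵐ s, s ∈ Ioo (-T₂) 0 → |B s| ≤ R) →
        (∀ᵐ s, s ∈ Ioo 0 t → |A s| ≤ q * |B (s - T₂)| + c * D) →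
        (∀ᵐ s, s ∈ Ioo 0 t → |B s| ≤ p * |A (s - T₁)| + c * D) →
        (∀ᵐ s, s ∈ Ioo (-T₁) t → |A s| ≤ C * Real.exp (-(ν * s)) * R + C' * D) ∧
        ∀ᵐ s, s ∈ Ioo (-T₂) t → |B s| ≤ C * Real.exp (-(ν * s)) * R + C' * D := by
  have hk : 0 < 1 - q * p := sub_pos.2 hqp
  -- `CA` and `CB` solve `CA = q CB + c`, `CB = p CA + c`. They do not involve `ν`, so the gain can
  -- be fixed before the rate.
  set CA := (1 + q) * c / (1 - q * p) with hCA
  set CB := (1 + p) * c / (1 - q * p) with hCB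
  have hCA0 : 0 ≤ CA := by positivity
  have hCB0 : 0 ≤ CB := by positivity
  have hCA1 : CA * (1 - q * p) = (1 + q) * c := div_mul_cancel₀ _ hk.ne'
  have hCB1 : CB * (1 - q * p) = (1 + p) * c := div_mul_cancel₀ _ hk.ne'
  have hA' : q * CB + c ≤ CA := by
    refine le_of_eq ((eq_div_iff hk.ne').2 ?_)
    linear_combination q * hCB1
  have hB' : p * CA + c ≤ CB := by
    refine le_of_eq ((eq_div_iff hk.ne').2 ?_)
    linear_combination p * hCA1
  refine ⟨CA + CB, by positivity, fun ν hν hdec => ?_⟩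
  set x := q * Real.exp (ν * T₂) with hx
  set y := p * Real.exp (ν * T₁) with hy
  have hx0 : 0 ≤ x := by positivity
  have hy0 : 0 ≤ y := by positivity
  have hxy : x * y ≤ 1 := by
    refine le_trans (le_of_eq ?_) hdec
    rw [hx, hy, mul_add, Real.exp_add]; ring
  -- The weights `1 + x` for `A` and `1 + y` for `B` are preserved by the recursion: `x (1 + y) ≤ 1
  -- + x` and `y (1 + x) ≤ 1 + y` both follow from `x y ≤ 1`. Equality is allowed, so the critical
  -- rate is attained.
  refine ⟨(1 + x) + (1 + y), by positivity, fun A B t R D ht hR hD hA hB hrA hrB => ?_⟩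
  set δ := min T₁ T₂ with hδ
  have hδ0 : 0 < δ := lt_min hT₁ hT₂
  have hδ₁ : δ ≤ T₁ := min_le_left _ _
  have hδ₂ : δ ≤ T₂ := min_le_right _ _
  have key : ∀ n : ℕ,
      (∀ᵐ s, s ∈ Ioo (-T₁) (min t (n * δ)) →
        |A s| ≤ (1 + x) * Real.exp (-(ν * s)) * R + CA * D) ∧
      ∀ᵐ s, s ∈ Ioo (-T₂) (min t (n * δ)) →
        |B s| ≤ (1 + y) * Real.exp (-(ν * s)) * R + CB * D := by
    intro n
    induction n with
    | zero =>
      have h0 : ∀ {z C s : ℝ}, 0 ≤ z → 0 ≤ C → s < 0 →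
          R ≤ (1 + z) * Real.exp (-(ν * s)) * R + C * D := fun {z C s} hz hC hs => by
        have he : 1 ≤ Real.exp (-(ν * s)) := Real.one_le_exp (by nlinarith)
        have : 1 * R ≤ (1 + z) * Real.exp (-(ν * s)) * R := by
          gcongr; exact one_le_mul_of_one_le_of_one_le (by linarith) he
        nlinarith [mul_nonneg hC hD]
      simp only [CharP.cast_eq_zero, zero_mul, min_eq_right ht]
      exact ⟨hA.mono fun s h hs => (h hs).trans (h0 hx0 hCA0 hs.2),
        hB.mono fun s h hs => (h hs).trans (h0 hy0 hCB0 hs.2)⟩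
    | succ n ih =>
      have hlt : ∀ {s τ : ℝ}, δ ≤ τ → s < min t ((n + 1 : ℕ) * δ) → s - τ < min t (n * δ) :=
        fun {s τ} hτ hs => by
          push_cast at hs
          obtain ⟨h1, h2⟩ := lt_min_iff.1 hs
          exact lt_min (by linarith) (by linarith)
      constructor
      · refine (delay_decay_step hν hq hR hD (by linarith) hCA0 hA hrA ih.2 (by nlinarith)
          hA').mono fun s h hs => h ⟨hs.1, hs.2.trans_le (min_le_left _ _)⟩ (hlt hδ₂ hs.2)
      · refine (delay_decay_step hν hp hR hD (by linarith) hCB0 hB hrB ih.1 (by nlinarith)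
          hB').mono fun s h hs => h ⟨hs.1, hs.2.trans_le (min_le_left _ _)⟩ (hlt hδ₁ hs.2)
  obtain ⟨n, hn⟩ := exists_nat_gt (t / δ)
  rw [div_lt_iff₀ hδ0] at hn
  have := key n
  rw [min_eq_left hn.le] at this
  refine ⟨this.1.mono fun s h hs => (h hs).trans (add_le_add (mul_le_mul_of_nonneg_right
    (mul_le_mul_of_nonneg_right ?_ (Real.exp_pos _).le) hR) (mul_le_mul_of_nonneg_right ?_ hD)),
    this.2.mono fun s h hs => (h hs).trans (add_le_add (mul_le_mul_of_nonneg_right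
    (mul_le_mul_of_nonneg_right ?_ (Real.exp_pos _).le) hR) (mul_le_mul_of_nonneg_right ?_ hD))⟩
  all_goals linarith

/-! ### Reflection of the space interval. -/

section Reflection

theorem measurePreserving_reflect : MeasurePreserving (fun x : ℝ => 1 - x) spaceMeasure
    spaceMeasure := by
  have h := (Measure.measurePreserving_sub_left (volume : Measure ℝ) 1).restrict_preimage
    (measurableSet_Ioo (a := (0 : ℝ)) (b := 1))
  simpa [spaceMeasure] using h

theorem reflect_mem_Icc {x : ℝ} (hx : x ∈ Icc (0 : ℝ) 1) : 1 - x ∈ Icc (0 : ℝ) 1 :=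
  ⟨by linarith [hx.2], by linarith [hx.1]⟩

theorem MeasureTheory.MemLp.reflect {f : ℝ → ℝ} (hf : MemLp f ∞ spaceMeasure) :
    MemLp (fun x => f (1 - x)) ∞ spaceMeasure :=
  hf.comp_measurePreserving measurePreserving_reflect

theorem IsBroadSolution.reflect {v : ℝ → ℝ} {K y : ℝ → ℝ → ℝ} (h : IsBroadSolution v K y) :
    IsBroadSolution (fun x => -v (1 - x)) (fun t x => K t (1 - x)) fun t x => y t (1 - x) := by
  intro a b x ha hab hx
  refine h a b (fun s => 1 - x s) ha hab fun s hs => ⟨reflect_mem_Icc (hx s hs).1, ?_⟩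
  simpa using (hx s hs).2.const_sub 1

theorem IsStateTrajectory.reflect {y : ℝ → ℝ → ℝ} (h : IsStateTrajectory y) :
    IsStateTrajectory fun t x => y t (1 - x) := by
  intro t ht
  refine ⟨(h t ht).1.reflect, (h t ht).2.congr' ?_⟩
  filter_upwards [self_mem_nhdsWithin] with s hs
  exact (eLpNorm_comp_measurePreserving ((h s hs).1.sub (h t ht).1).1
    measurePreserving_reflect).symm

theorem transportTime_reflect (v : ℝ → ℝ) :
    transportTime (fun x => v (1 - x)) = transportTime v := by
  simpa [transportTime] using
    intervalIntegral.integral_comp_sub_left (a := 0) (b := 1) (fun x => 1 / v x) 1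

theorem ContinuousOn.reflect {v : ℝ → ℝ} (hv : ContinuousOn v (Icc 0 1)) :
    ContinuousOn (fun x => v (1 - x)) (Icc 0 1) :=
  hv.comp (by fun_prop) fun _ hx => reflect_mem_Icc hx

end Reflection

/-! ### Componentwise bounds and the norms of state and inputs. -/

section Norms

theorem ae_norm_le_toReal_eLpNorm {α E : Type*} {m : MeasurableSpace α} [NormedAddCommGroup E]
    {μ : Measure α} {f : α → E} (hf : eLpNorm f ∞ μ ≠ ∞) :
    ∀ᵐ x ∂μ, ‖f x‖ ≤ (eLpNorm f ∞ μ).toReal := by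
  filter_upwards [ae_le_eLpNormEssSup (f := f) (μ := μ)] with s hs
  rw [← eLpNorm_exponent_top] at hs
  simpa using ENNReal.toReal_mono hf hs

theorem MeasureTheory.MemLp.euclidean {α ι : Type*} [Fintype ι] {m : MeasurableSpace α}
    {μ : Measure α} {p : ℝ≥0∞} {f : α → EuclideanSpace ℝ ι}
    (hf : ∀ i, MemLp (fun x => f x i) p μ) : MemLp f p μ := by
  classical
  have := memLp_finsetSum' Finset.univ fun i _ =>
    (ContinuousLinearMap.toSpanSingleton ℝ (EuclideanSpace.single i (1 : ℝ))).comp_memLp' (hf i)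
  refine this.ae_eq (ae_of_all _ fun x => ?_)
  ext j
  simp [Finset.sum_apply, Pi.single_apply]

theorem abs_le_stateNorm {a b : ℝ → ℝ} (ha : MemLp a ∞ spaceMeasure)
    (hb : MemLp b ∞ spaceMeasure) :
    ∀ᵐ x ∂spaceMeasure, |a x| ≤ stateNorm a b ∧ |b x| ≤ stateNorm a b := by
  have h : MemLp (fun x => (!₂[a x, b x] : EuclideanSpace ℝ (Fin 2))) ∞ spaceMeasure :=
    MemLp.euclidean fun i => by fin_cases i <;> simpa
  filter_upwards [ae_norm_le_toReal_eLpNorm h.2.ne] with x hx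
  exact ⟨(PiLp.norm_apply_le (!₂[a x, b x] : EuclideanSpace ℝ (Fin 2)) 0).trans hx,
    (PiLp.norm_apply_le (!₂[a x, b x] : EuclideanSpace ℝ (Fin 2)) 1).trans hx⟩

theorem stateNorm_le {a b : ℝ → ℝ} {A B : ℝ} (hA : 0 ≤ A) (hB : 0 ≤ B)
    (ha : ∀ᵐ x ∂spaceMeasure, |a x| ≤ A) (hb : ∀ᵐ x ∂spaceMeasure, |b x| ≤ B) :
    stateNorm a b ≤ A + B := by
  refine ENNReal.toReal_le_of_le_ofReal (add_nonneg hA hB) ?_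
  rw [eLpNorm_exponent_top]
  refine eLpNormEssSup_le_of_ae_bound ?_
  filter_upwards [ha, hb] with x hx hx'
  rw [EuclideanSpace.norm_eq]
  refine Real.sqrt_le_iff.2 ⟨add_nonneg hA hB, ?_⟩
  simp only [Fin.sum_univ_two, Real.norm_eq_abs]
  have h1 := abs_nonneg (a x)
  have h2 := abs_nonneg (b x)
  change |a x| ^ 2 + |b x| ^ 2 ≤ _
  nlinarith

theorem abs_le_inputNorm {n : ℝ → ℝ} {d : Fin 4 → ℝ → ℝ} (hn : IsLocallyEssBounded n)
    (hd : ∀ i, IsLocallyEssBounded (d i)) (t : ℝ) :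
    ∀ᵐ s, s ∈ Ioo 0 t → |n s| ≤ inputNorm n d t ∧ ∀ i, |d i s| ≤ inputNorm n d t := by
  have h : MemLp (fun s => (!₂[n s, d 0 s, d 1 s, d 2 s, d 3 s] : EuclideanSpace ℝ (Fin 5))) ∞
      (volume.restrict (Ioo 0 t)) :=
    MemLp.euclidean fun i => by
      fin_cases i
      exacts [hn t, hd 0 t, hd 1 t, hd 2 t, hd 3 t]
  rw [← ae_restrict_iff' measurableSet_Ioo]
  filter_upwards [ae_norm_le_toReal_eLpNorm h.2.ne] with s hs
  have key := fun i => (PiLp.norm_apply_le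
    (!₂[n s, d 0 s, d 1 s, d 2 s, d 3 s] : EuclideanSpace ℝ (Fin 5)) i).trans hs
  refine ⟨key 0, fun i => ?_⟩
  fin_cases i
  exacts [key 1, key 2, key 3, key 4]

end Norms

/-! ### Source terms and boundedness of the backstepping coefficients. -/

section Sources

theorem sourceTerm_eq_sum (n : ℝ → ℝ) (d f : Fin 4 → ℝ → ℝ) :
    sourceTerm n d f = fun t x => ∑ i, ![n, d 0, d 1, d 3] i t * f i x := by
  ext t x
  simp [sourceTerm, Fin.sum_univ_four]

theorem isLocallyEssBounded_inputs {n : ℝ → ℝ} {d : Fin 4 → ℝ → ℝ} (hn : IsLocallyEssBounded n)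
    (hd : ∀ i, IsLocallyEssBounded (d i)) (i : Fin 4) :
    IsLocallyEssBounded (![n, d 0, d 1, d 3] i) := by
  fin_cases i
  exacts [hn, hd 0, hd 1, hd 3]

/-- With `|P| ≤ M` and `|Q| ≤ M'`, the integral term is at most the integral of `M |f| + M' |g|`
over the whole interval, finite by integrability. One use of the equation gives boundedness, with no
iteration. -/
theorem IsVolterraSolution.memLp_top {Puu Puv Pvu Pvv : ℝ → ℝ → ℝ} {S R f g : ℝ → ℝ}
    (h : IsVolterraSolution Puu Puv Pvu Pvv S R f g) (huu : IsBoundedKernel Puu)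
    (huv : IsBoundedKernel Puv) (hvu : IsBoundedKernel Pvu) (hvv : IsBoundedKernel Pvv)
    (hS : ∃ C, ∀ x ∈ Icc (0 : ℝ) 1, |S x| ≤ C) (hR : ∃ C, ∀ x ∈ Icc (0 : ℝ) 1, |R x| ≤ C) :
    MemLp f ∞ spaceMeasure ∧ MemLp g ∞ spaceMeasure := by
  obtain ⟨hf, hg, heq⟩ := h
  have hint : ∀ {u : ℝ → ℝ}, Integrable u spaceMeasure → IntervalIntegrable u volume 0 1 :=
    fun hu => (intervalIntegrable_iff_integrableOn_Ioo_of_le zero_le_one).2 hu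
  have key : ∀ {P Q : ℝ → ℝ → ℝ} {S u : ℝ → ℝ}, IsBoundedKernel P → IsBoundedKernel Q →
      (∃ C, ∀ x ∈ Icc (0 : ℝ) 1, |S x| ≤ C) → Integrable u spaceMeasure →
      (∀ x ∈ Icc (0 : ℝ) 1, u x = S x + ∫ ξ in x..1, (P x ξ * f ξ + Q x ξ * g ξ)) →
      MemLp u ∞ spaceMeasure := by
    rintro P Q S u ⟨-, M, hM⟩ ⟨-, M', hM'⟩ ⟨C, hC⟩ hu hux
    have hi : IntervalIntegrable (fun ξ => M * |f ξ| + M' * |g ξ|) volume 0 1 :=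
      ((hint hf).abs.const_mul M).add ((hint hg).abs.const_mul M')
    have hM0 : 0 ≤ M := (abs_nonneg _).trans (hM (0, 1) ⟨le_rfl, zero_le_one, le_rfl⟩)
    have hM0' : 0 ≤ M' := (abs_nonneg _).trans (hM' (0, 1) ⟨le_rfl, zero_le_one, le_rfl⟩)
    refine memLp_top_iff_exists_bound.2 ⟨hu.1, C + ∫ ξ in (0 : ℝ)..1, (M * |f ξ| + M' * |g ξ|), ?_⟩
    filter_upwards [ae_restrict_mem measurableSet_Ioo] with x hx
    have hx' := Ioo_subset_Icc_self hx
    rw [hux x hx']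
    refine (abs_add_le _ _).trans (add_le_add (hC x hx') ?_)
    have hsub : uIcc x 1 ⊆ uIcc 0 1 := by
      rw [uIcc_of_le hx'.2, uIcc_of_le zero_le_one]; exact Icc_subset_Icc_left hx'.1
    refine (intervalIntegral.norm_integral_le_of_norm_le
      (f := fun ξ => P x ξ * f ξ + Q x ξ * g ξ) hx'.2 (ae_of_all _ fun ξ hξ => ?_)
      (hi.mono_set hsub)).trans ?_
    · have hm : (x, ξ) ∈ kernelTriangle := ⟨hx'.1, hξ.1.le, hξ.2⟩
      refine (norm_add_le _ _).trans (add_le_add ?_ ?_)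
      · rw [norm_mul]; exact mul_le_mul_of_nonneg_right (hM _ hm) (abs_nonneg _)
      · rw [norm_mul]; exact mul_le_mul_of_nonneg_right (hM' _ hm) (abs_nonneg _)
    · refine intervalIntegral.integral_mono_interval hx'.1 hx'.2 le_rfl (ae_of_all _ fun ξ => ?_) hi
      simp only [Pi.zero_apply]
      positivity
  exact ⟨key huu huv hS hf fun x hx => (heq x hx).1, key hvu hvv hR hg fun x hx => (heq x hx).2⟩

theorem IsBacksteppingSource.memLp_top {lam mu : ℝ → ℝ} {ρ ε : ℝ} {Puu Puv Pvu Pvv : ℝ → ℝ → ℝ}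
    {m₁ m₂ : ℝ → ℝ} {f g : Fin 4 → ℝ → ℝ}
    (h : IsBacksteppingSource lam mu ρ ε Puu Puv Pvu Pvv m₁ m₂ f g) (huu : IsBoundedKernel Puu)
    (huv : IsBoundedKernel Puv) (hvu : IsBoundedKernel Pvu) (hvv : IsBoundedKernel Pvv)
    (hm₁ : ContinuousOn m₁ (Icc 0 1)) (hm₂ : ContinuousOn m₂ (Icc 0 1)) :
    ∀ i, MemLp (f i) ∞ spaceMeasure ∧ MemLp (g i) ∞ spaceMeasure := by
  have hlin : ∀ {P Q : ℝ → ℝ → ℝ} (a b : ℝ), IsBoundedKernel P → IsBoundedKernel Q →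
      ∃ C, ∀ x ∈ Icc (0 : ℝ) 1, |a * P x 1 + b * Q x 1| ≤ C := by
    rintro P Q a b ⟨-, M, hM⟩ ⟨-, M', hM'⟩
    refine ⟨|a| * M + |b| * M', fun x hx => (abs_add_le _ _).trans ?_⟩
    rw [abs_mul, abs_mul]
    gcongr
    exacts [hM (x, 1) ⟨hx.1, hx.2, le_rfl⟩, hM' (x, 1) ⟨hx.1, hx.2, le_rfl⟩]
  have hgain : ∀ {P Q : ℝ → ℝ → ℝ}, IsBoundedKernel P → IsBoundedKernel Q →
      ∃ C, ∀ x ∈ Icc (0 : ℝ) 1,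
        |-observerGain lam mu ρ ε P Q x - mu 1 * ρ * ε * Q x 1| ≤ C := fun {P Q} hP hQ => by
    obtain ⟨C, hC⟩ := hlin (lam 1) (-(mu 1 * ρ * (1 - ε)) - mu 1 * ρ * ε) hP hQ
    refine ⟨C, fun x hx => (le_of_eq ?_).trans (hC x hx)⟩
    rw [observerGain]; congr 1; ring
  have hone : ∀ {Q : ℝ → ℝ → ℝ}, IsBoundedKernel Q →
      ∃ C, ∀ x ∈ Icc (0 : ℝ) 1, |mu 1 * Q x 1| ≤ C := fun {Q} hQ => by
    simpa using hlin 0 (mu 1) hQ hQ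
  have hzero : ∃ C : ℝ, ∀ x ∈ Icc (0 : ℝ) 1, |(0 : ℝ)| ≤ C := ⟨0, fun _ _ => by simp⟩
  intro i
  fin_cases i
  · exact h.noise.memLp_top huu huv hvu hvv (hgain huu huv) (hgain hvu hvv)
  · exact h.dist_one.memLp_top huu huv hvu hvv
      (isCompact_Icc.exists_bound_of_continuousOn hm₁) hzero
  · exact h.dist_two.memLp_top huu huv hvu hvv hzero
      (isCompact_Icc.exists_bound_of_continuousOn hm₂)
  · exact h.dist_four.memLp_top huu huv hvu hvv (hone huv) (hone hvv)

end Sources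

/-! ### Bounds passing between profile and state. -/

namespace IsTravelTime

variable {v φ χ : ℝ → ℝ} {T : ℝ}

theorem quasiMeasurePreserving_past (h : IsTravelTime v T φ χ) :
    Measure.QuasiMeasurePreserving (fun s => χ (0 - s)) (volume.restrict (Ioo (-T) 0))
      spaceMeasure :=
  h.quasiMeasurePreserving_restrict_inv.comp
    (quasiMeasurePreserving_restrict_sub_left (by simp) (by simp))

theorem ae_past_of_ae_initial (h : IsTravelTime v T φ χ) {A : ℝ → ℝ} {R : ℝ}
    (hA : ∀ᵐ x ∂spaceMeasure, |A (-φ x)| ≤ R) : ∀ᵐ s, s ∈ Ioo (-T) 0 → |A s| ≤ R := by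
  rw [← ae_restrict_iff' measurableSet_Ioo]
  filter_upwards [h.quasiMeasurePreserving_past.ae hA] with s hs
  simpa [h.right_inv] using hs

/-- A bound on the profile gives a bound on the state. -/
theorem ae_abs_profile_le (h : IsTravelTime v T φ χ) {A : ℝ → ℝ} {w f : Fin 4 → ℝ → ℝ}
    (hf : ∀ i, MemLp (f i) ∞ spaceMeasure) {t C C' R D ν : ℝ} (ht : 0 ≤ t) (hν : 0 ≤ ν)
    (hC : 0 ≤ C) (hR : 0 ≤ R) (hD : 0 ≤ D) (hw : ∀ i, ∀ᵐ s, s ∈ Ioo 0 t → |w i s| ≤ D)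
    (hA : ∀ᵐ s, s ∈ Ioo (-T) t → |A s| ≤ C * Real.exp (-(ν * s)) * R + C' * D) :
    ∀ᵐ x ∂spaceMeasure,
      |A (t - φ x) + duhamel w (fun i => travelCoeff χ T (f i)) t (t - φ x)| ≤
        C * Real.exp (ν * T) * Real.exp (-(ν * t)) * R +
          (C' + ∑ i, ∫ s, |travelCoeff χ T (f i) s|) * D := by
  rw [← ae_restrict_iff' measurableSet_Ioo] at hA
  filter_upwards [(h.quasiMeasurePreserving_sub ht le_rfl).ae hA,
    ae_restrict_mem measurableSet_Ioo] with x hx hm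
  have hG := abs_duhamel_sum_le (fun i => h.integrable_travelCoeff (hf i)) ht hD hw (t - φ x)
  -- The state at time `t` sees profile values at most `T` older, whence the loss of `exp (ν T)`.
  have hexp : Real.exp (-(ν * (t - φ x))) ≤ Real.exp (ν * T) * Real.exp (-(ν * t)) := by
    rw [← Real.exp_add]
    refine Real.exp_le_exp.2 ?_
    nlinarith [(h.mem_Ioo hm).2]
  have h1 : C * Real.exp (-(ν * (t - φ x))) * R ≤
      C * (Real.exp (ν * T) * Real.exp (-(ν * t))) * R := by gcongr
  refine (abs_add_le _ _).trans ((add_le_add hx hG).trans ?_)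
  linarith

end IsTravelTime

/-! ### Existence and stability estimate for the coupled system. -/

section System

variable {lam mu φ χ ψ ω : ℝ → ℝ} {T₁ T₂ q ρ ε : ℝ} {f g : Fin 4 → ℝ → ℝ}

theorem exists_isObserverErrorSolution (hlam : ContinuousOn lam (Icc 0 1))
    (hmu : ContinuousOn mu (Icc 0 1)) (hlam_pos : ∀ x ∈ Icc (0 : ℝ) 1, 0 < lam x)
    (hmu_pos : ∀ x ∈ Icc (0 : ℝ) 1, 0 < mu x) (h₁ : IsTravelTime lam T₁ φ χ)
    (h₂ : IsTravelTime (fun x => mu (1 - x)) T₂ ψ ω) (hf : ∀ i, MemLp (f i) ∞ spaceMeasure)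
    (hg : ∀ i, MemLp (g i) ∞ spaceMeasure) {α₀ β₀ n : ℝ → ℝ} {d : Fin 4 → ℝ → ℝ}
    (hα₀ : MemLp α₀ ∞ spaceMeasure) (hβ₀ : MemLp β₀ ∞ spaceMeasure) (hn : IsLocallyEssBounded n)
    (hd : ∀ i, IsLocallyEssBounded (d i)) :
    ∃ α β, IsObserverErrorSolution lam mu q ρ ε f g n d α₀ β₀ α β := by
  have hw := isLocallyEssBounded_inputs hn hd
  set w : Fin 4 → ℝ → ℝ := ![n, d 0, d 1, d 3] with hwdef
  have hg' : ∀ i, MemLp (fun x => g i (1 - x)) ∞ spaceMeasure := fun i => (hg i).reflect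
  set G₁ := duhamel w fun i => travelCoeff χ T₁ (f i) with hG₁
  set G₂ := duhamel w fun i => travelCoeff ω T₂ fun x => g i (1 - x) with hG₂
  have hmem : ∀ {G : ℝ → ℝ}, ContinuousOn G (Ici 0) → ∀ t,
      MemLp G ∞ (volume.restrict (Ioo 0 t)) := fun {G} hG t => by
    obtain ⟨C, hC⟩ := (isCompact_Icc (a := 0) (b := t)).exists_bound_of_continuousOn
      (hG.mono Icc_subset_Ici_self)
    refine memLp_top_iff_exists_bound.2 ⟨(hG.mono fun s hs => le_of_lt hs.1).aestronglyMeasurable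
      measurableSet_Ioo, C, ?_⟩
    filter_upwards [ae_restrict_mem measurableSet_Ioo] with s hs
    exact hC s (Ioo_subset_Icc_self hs)
  -- At the outflow ends the Duhamel terms are continuous in time, hence admissible as forcing of
  -- the difference equations.
  have hG₁m := hmem (continuousOn_duhamel hw (fun i => h₁.integrable_travelCoeff (hf i))
    (fun i => h₁.exists_bound_travelCoeff (hf i)) T₁)
  have hG₂m := hmem (continuousOn_duhamel hw (fun i => h₂.integrable_travelCoeff (hg' i))
    (fun i => h₂.exists_bound_travelCoeff (hg' i)) T₂)
  -- The past of the profiles encodes the initial data, read backwards along characteristics; the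
  -- forcing joins the Duhamel term arriving from the opposite boundary with the boundary inputs.
  obtain ⟨A, B, hA, hB, hpast, hfut⟩ := exists_delay_solution (T₁ := T₁) (T₂ := T₂) q (ρ * (1 - ε))
    (a := fun s => α₀ (χ (0 - s))) (b := fun s => β₀ (1 - ω (0 - s)))
    (e₁ := fun t => q * G₂ t (t - T₂) + d 2 t)
    (e₂ := fun t => ρ * (1 - ε) * G₁ t (t - T₁) + (d 3 t - ρ * ε * n t))
    h₁.time_pos h₂.time_pos
    (hα₀.top_comp_quasiMeasurePreserving h₁.quasiMeasurePreserving_past)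
    (hβ₀.reflect.top_comp_quasiMeasurePreserving h₂.quasiMeasurePreserving_past)
    (fun t => ((hG₂m t).const_mul q).add (hd 2 t))
    (fun t => ((hG₁m t).const_mul (ρ * (1 - ε))).add ((hd 3 t).sub ((hn t).const_mul (ρ * ε))))
  have hself₁ : ∀ t, 0 ≤ t → G₁ t t = 0 := fun t =>
    duhamel_self fun i θ hθ => travelCoeff_of_neg hθ
  have hself₂ : ∀ t, 0 ≤ t → G₂ t t = 0 := fun t =>
    duhamel_self fun i θ hθ => travelCoeff_of_neg hθ
  refine ⟨fun t x => A (t - φ x) + G₁ t (t - φ x),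
    fun t x => B (t - ψ (1 - x)) + G₂ t (t - ψ (1 - x)), ?_, ?_, ?_, ?_, ?_, ?_, ?_, ?_⟩
  · exact h₁.isStateTrajectory_of_profile hlam hw hf hA
  · exact (h₂.isStateTrajectory_of_profile hmu.reflect hw hg' hB).reflect
  · rw [sourceTerm_eq_sum]
    exact h₁.isBroadSolution_of_profile hlam_pos hw hf A
  · rw [sourceTerm_eq_sum, ← hwdef]
    simpa only [neg_neg, sub_sub_cancel] using (h₂.isBroadSolution_of_profile (fun x hx => hmu_pos _ (reflect_mem_Icc hx))
      hw hg' B).reflect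
  · filter_upwards [ae_restrict_mem measurableSet_Ioi] with t ht
    have ht' : 0 ≤ t := le_of_lt ht
    simp only [h₁.map_zero, sub_zero, h₂.map_one, hself₁ t ht', add_zero, (hfut t ht').1]
    ring
  · filter_upwards [ae_restrict_mem measurableSet_Ioi] with t ht
    have ht' : 0 ≤ t := le_of_lt ht
    simp only [h₁.map_one, sub_zero, sub_self, h₂.map_zero, hself₂ t ht', add_zero, (hfut t ht').2]
    ring
  · filter_upwards [ae_restrict_mem measurableSet_Ioo] with x hx
    have : (0 : ℝ) - φ x < 0 := by linarith [(h₁.mem_Ioo hx).1]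
    simp only [hG₁, duhamel_zero, add_zero, (hpast _ this).1, sub_sub_cancel, h₁.left_inv]
  · filter_upwards [ae_restrict_mem measurableSet_Ioo] with x hx
    have hx' : 1 - x ∈ Ioo (0 : ℝ) 1 := ⟨by linarith [hx.2], by linarith [hx.1]⟩
    have : (0 : ℝ) - ψ (1 - x) < 0 := by linarith [(h₂.mem_Ioo hx').1]
    simp only [hG₂, duhamel_zero, add_zero, (hpast _ this).2, sub_sub_cancel, h₂.left_inv]

theorem IsObserverErrorSolution.exists_profiles {n α₀ β₀ : ℝ → ℝ} {d : Fin 4 → ℝ → ℝ}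
    {α β : ℝ → ℝ → ℝ} (hlam_pos : ∀ x ∈ Icc (0 : ℝ) 1, 0 < lam x)
    (hmu_pos : ∀ x ∈ Icc (0 : ℝ) 1, 0 < mu x) (h₁ : IsTravelTime lam T₁ φ χ)
    (h₂ : IsTravelTime (fun x => mu (1 - x)) T₂ ψ ω) (hf : ∀ i, MemLp (f i) ∞ spaceMeasure)
    (hg : ∀ i, MemLp (g i) ∞ spaceMeasure) (hn : IsLocallyEssBounded n)
    (hd : ∀ i, IsLocallyEssBounded (d i))
    (hsol : IsObserverErrorSolution lam mu q ρ ε f g n d α₀ β₀ α β) :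
    ∃ A B : ℝ → ℝ,
      (∀ t x, 0 ≤ t → x ∈ Icc (0 : ℝ) 1 → α t x = A (t - φ x) +
        duhamel ![n, d 0, d 1, d 3] (fun i => travelCoeff χ T₁ (f i)) t (t - φ x)) ∧
      ∀ t x, 0 ≤ t → x ∈ Icc (0 : ℝ) 1 → β t (1 - x) = B (t - ψ x) +
        duhamel ![n, d 0, d 1, d 3] (fun i => travelCoeff ω T₂ fun x => g i (1 - x)) t
          (t - ψ x) := by
  have hw := isLocallyEssBounded_inputs hn hd
  have ha := hsol.transport_left
  have hb := hsol.transport_right.reflect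
  rw [sourceTerm_eq_sum] at ha hb
  simp only [neg_neg] at hb
  obtain ⟨A, hA⟩ := h₁.exists_profile hlam_pos hw hf ha
  obtain ⟨B, hB⟩ := h₂.exists_profile (fun x hx => hmu_pos _ (reflect_mem_Icc hx)) hw
    (fun i => (hg i).reflect) hb
  exact ⟨A, B, hA, hB⟩

/-- Both boundary conditions have this shape: `a₁` is the delayed profile, `a₂` the Duhamel term,
and `e` the direct input. The constant `1 + |ρ * ε|` covers `d₃` as well as `d₄ - ρ ε n`. -/
theorem abs_boundary_le {k a₁ a₂ M D e : ℝ} (h₁ : |a₂| ≤ M * D) (he : |e| ≤ (1 + |ρ * ε|) * D)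
    (hk : k = q * (a₁ + a₂) + e) : |k| ≤ |q| * |a₁| + (|q| * M + 1 + |ρ * ε|) * D := by
  rw [hk]
  refine (abs_add_le _ _).trans ?_
  rw [abs_mul]
  have := mul_le_mul_of_nonneg_left ((abs_add_le a₁ a₂).trans (add_le_add le_rfl h₁)) (abs_nonneg q)
  linarith

/-- Input-to-state estimate in terms of the decay rates admitted by the loop gain. -/
theorem exists_stateNorm_le (hlam_pos : ∀ x ∈ Icc (0 : ℝ) 1, 0 < lam x)
    (hmu_pos : ∀ x ∈ Icc (0 : ℝ) 1, 0 < mu x) (h₁ : IsTravelTime lam T₁ φ χ)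
    (h₂ : IsTravelTime (fun x => mu (1 - x)) T₂ ψ ω) (hf : ∀ i, MemLp (f i) ∞ spaceMeasure)
    (hg : ∀ i, MemLp (g i) ∞ spaceMeasure) (hk : |q| * |ρ * (1 - ε)| < 1) :
    ∃ C', 0 ≤ C' ∧ ∀ ν, 0 ≤ ν → |q| * |ρ * (1 - ε)| * Real.exp (ν * (T₁ + T₂)) ≤ 1 → ∃ C, 0 ≤ C ∧
      ∀ (α₀ β₀ n : ℝ → ℝ) (d : Fin 4 → ℝ → ℝ) (α β : ℝ → ℝ → ℝ),
        MemLp α₀ ∞ spaceMeasure → MemLp β₀ ∞ spaceMeasure → IsLocallyEssBounded n →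
        (∀ i, IsLocallyEssBounded (d i)) →
        IsObserverErrorSolution lam mu q ρ ε f g n d α₀ β₀ α β → ∀ t, 0 ≤ t →
          stateNorm (α t) (β t) ≤
            C' * inputNorm n d t + C * Real.exp (-(ν * t)) * stateNorm α₀ β₀ := by
  set M₁ := ∑ i, ∫ s, |travelCoeff χ T₁ (f i) s| with hM₁
  set M₂ := ∑ i, ∫ s, |travelCoeff ω T₂ (fun x => g i (1 - x)) s| with hM₂
  have hM₁0 : 0 ≤ M₁ := Finset.sum_nonneg fun i _ => integral_nonneg fun s => abs_nonneg _
  have hM₂0 : 0 ≤ M₂ := Finset.sum_nonneg fun i _ => integral_nonneg fun s => abs_nonneg _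
  set p := ρ * (1 - ε) with hp
  -- A common constant for both equations, dominating the two instances of `abs_boundary_le`.
  set c := |q| * M₂ + |p| * M₁ + 1 + |ρ * ε| with hc
  have hqM := mul_nonneg (abs_nonneg q) hM₂0
  have hpM := mul_nonneg (abs_nonneg p) hM₁0
  obtain ⟨C', hC', hdec⟩ := delay_decay (c := c) h₁.time_pos h₂.time_pos (abs_nonneg q)
    (abs_nonneg p) hk (by positivity)
  refine ⟨(C' + M₁) + (C' + M₂), by positivity, fun ν hν hνk => ?_⟩
  obtain ⟨C, hC, hdec⟩ := hdec ν hν hνk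
  refine ⟨C * Real.exp (ν * T₁) + C * Real.exp (ν * T₂), by positivity, ?_⟩
  intro α₀ β₀ n d α β hα₀ hβ₀ hn hd hsol t ht
  obtain ⟨A, B, hA, hB⟩ := hsol.exists_profiles hlam_pos hmu_pos h₁ h₂ hf hg hn hd
  have hg' : ∀ i, MemLp (fun x => g i (1 - x)) ∞ spaceMeasure := fun i => (hg i).reflect
  set R := stateNorm α₀ β₀ with hR
  set D := inputNorm n d t with hD
  have hR0 : 0 ≤ R := ENNReal.toReal_nonneg
  have hD0 : 0 ≤ D := ENNReal.toReal_nonneg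
  have hin := abs_le_inputNorm hn hd t
  have hw : ∀ i, ∀ᵐ s, s ∈ Ioo 0 t → |(![n, d 0, d 1, d 3] : Fin 4 → ℝ → ℝ) i s| ≤ D := by
    intro i
    filter_upwards [hin] with s hs hm
    obtain ⟨hsn, hsd⟩ := hs hm
    fin_cases i
    exacts [hsn, hsd 0, hsd 1, hsd 3]
  have h0 : (0 : ℝ) ∈ Icc (0 : ℝ) 1 := left_mem_Icc.2 zero_le_one
  have h1 : (1 : ℝ) ∈ Icc (0 : ℝ) 1 := right_mem_Icc.2 zero_le_one
  have hinit := abs_le_stateNorm hα₀ hβ₀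
  have hA0 : ∀ᵐ s, s ∈ Ioo (-T₁) 0 → |A s| ≤ R := by
    refine h₁.ae_past_of_ae_initial ?_
    filter_upwards [hinit, hsol.initial_left, ae_restrict_mem measurableSet_Ioo] with x hx hx0 hm
    have := hA 0 x le_rfl (Ioo_subset_Icc_self hm)
    rw [duhamel_zero, add_zero, zero_sub, hx0] at this
    rw [← this]; exact hx.1
  have hB0 : ∀ᵐ s, s ∈ Ioo (-T₂) 0 → |B s| ≤ R := by
    refine h₂.ae_past_of_ae_initial ?_
    have hrefl := measurePreserving_reflect.quasiMeasurePreserving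
    filter_upwards [hrefl.ae hinit, hrefl.ae hsol.initial_right, ae_restrict_mem measurableSet_Ioo]
      with x hx hx0 hm
    have := hB 0 x le_rfl (Ioo_subset_Icc_self hm)
    rw [duhamel_zero, add_zero, zero_sub, hx0] at this
    rw [← this]; exact hx.2
  have hG₁ : ∀ s ∈ Ioo 0 t, ∀ r,
      |duhamel ![n, d 0, d 1, d 3] (fun i => travelCoeff χ T₁ (f i)) s r| ≤ M₁ * D :=
    fun s hs r => abs_duhamel_sum_le (fun i => h₁.integrable_travelCoeff (hf i)) hs.1.le hD0
      (fun i => (hw i).mono fun u hu hm => hu ⟨hm.1, hm.2.trans hs.2⟩) r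
  have hG₂ : ∀ s ∈ Ioo 0 t, ∀ r,
      |duhamel ![n, d 0, d 1, d 3] (fun i => travelCoeff ω T₂ fun x => g i (1 - x)) s r| ≤
        M₂ * D :=
    fun s hs r => abs_duhamel_sum_le (fun i => h₂.integrable_travelCoeff (hg' i)) hs.1.le hD0
      (fun i => (hw i).mono fun u hu hm => hu ⟨hm.1, hm.2.trans hs.2⟩) r
  have hrA : ∀ᵐ s, s ∈ Ioo 0 t → |A s| ≤ |q| * |B (s - T₂)| + c * D := by
    filter_upwards [hin, (ae_restrict_iff' measurableSet_Ioi).1 hsol.boundary_zero]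
      with s hs hbc hm
    have hb := hbc hm.1
    -- Writing `0` as `1 - 1` lets the value of `β` at `0` be read as the outflow value of the
    -- reflected profile.
    rw [hA s 0 hm.1.le h0, h₁.map_zero, sub_zero, duhamel_self
      (fun i θ hθ => travelCoeff_of_neg hθ) hm.1.le, add_zero, ← sub_self (1 : ℝ),
      hB s 1 hm.1.le h1, h₂.map_one] at hb
    have he : |d 2 s| ≤ (1 + |ρ * ε|) * D := by
      nlinarith [(hs hm).2 2, mul_nonneg (abs_nonneg (ρ * ε)) hD0]
    refine (abs_boundary_le (hG₂ s hm _) he hb).trans ?_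
    have := mul_nonneg hpM hD0
    rw [hc]; linarith
  have hrB : ∀ᵐ s, s ∈ Ioo 0 t → |B s| ≤ |p| * |A (s - T₁)| + c * D := by
    filter_upwards [hin, (ae_restrict_iff' measurableSet_Ioi).1 hsol.boundary_one]
      with s hs hbc hm
    have hb := hbc hm.1
    rw [hA s 1 hm.1.le h1, h₁.map_one] at hb
    have hb1 := hB s 0 hm.1.le h0
    rw [sub_zero, h₂.map_zero, sub_zero, duhamel_self
      (fun i θ hθ => travelCoeff_of_neg hθ) hm.1.le, add_zero] at hb1
    rw [hb1, add_sub_assoc] at hb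
    have he : |d 3 s - ρ * ε * n s| ≤ (1 + |ρ * ε|) * D := by
      refine (abs_sub _ _).trans ?_
      rw [abs_mul]
      have := mul_le_mul_of_nonneg_left (hs hm).1 (abs_nonneg (ρ * ε))
      linarith [(hs hm).2 3]
    refine (abs_boundary_le (hG₁ s hm _) he hb).trans ?_
    have := mul_nonneg hqM hD0
    rw [hc]; linarith
  obtain ⟨hA', hB'⟩ := hdec A B t R D ht hR0 hD0 hA0 hB0 hrA hrB
  have hα := h₁.ae_abs_profile_le hf ht hν hC hR0 hD0 hw hA'
  have hβ := h₂.ae_abs_profile_le hg' ht hν hC hR0 hD0 hw hB'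
  have hαt : ∀ᵐ x ∂spaceMeasure, |α t x| ≤
      C * Real.exp (ν * T₁) * Real.exp (-(ν * t)) * R + (C' + M₁) * D := by
    filter_upwards [hα, ae_restrict_mem measurableSet_Ioo] with x hx hm
    rwa [hA t x ht (Ioo_subset_Icc_self hm)]
  have hβt : ∀ᵐ x ∂spaceMeasure, |β t x| ≤
      C * Real.exp (ν * T₂) * Real.exp (-(ν * t)) * R + (C' + M₂) * D := by
    filter_upwards [measurePreserving_reflect.quasiMeasurePreserving.ae hβ,
      ae_restrict_mem measurableSet_Ioo] with x hx hm
    rwa [← hB t (1 - x) ht (reflect_mem_Icc (Ioo_subset_Icc_self hm)), sub_sub_cancel] at hx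
  refine (stateNorm_le (by positivity) (by positivity) hαt hβt).trans_eq ?_
  ring

end System

/-! ### Comparison functions, the loop gain and the conclusion. -/

theorem isClassK_const_mul {C : ℝ} (hC : 0 < C) : IsClassK fun r => C * r :=
  ⟨by fun_prop, fun _ _ _ _ h => mul_lt_mul_of_pos_left h hC, mul_zero C⟩

theorem isClassKL_exp {C ν : ℝ} (hC : 0 < C) (hν : 0 < ν) :
    IsClassKL fun r t => C * Real.exp (-(ν * t)) * r := by
  refine ⟨fun t _ => isClassK_const_mul (mul_pos hC (Real.exp_pos _)), fun r hr => ⟨?_, ?_⟩⟩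
  · intro s _ t _ hst
    simp only
    gcongr
  · have h : Tendsto (fun t => Real.exp (-(ν * t))) atTop (𝓝 0) :=
      Real.tendsto_exp_neg_atTop_nhds_zero.comp (tendsto_id.const_mul_atTop hν)
    simpa using (h.const_mul C).mul_const r

/-- This is where the restriction on ε enters: as `1 - ε ≥ 0`, the lower bound on ε says exactly
that the loop gain is below one, unless `q ρ = 0`, when the gain vanishes. -/
theorem abs_mul_lt_one_of_reflection {q ρ ε : ℝ} (hε : ρ ≠ 0 → 1 - 1 / |ρ * q| < ε)
    (hε_one : ε ≤ 1) : |q| * |ρ * (1 - ε)| < 1 := by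
  rcases eq_or_ne (q * ρ) 0 with h | h
  · rw [← abs_mul, ← mul_assoc, h, zero_mul, abs_zero]; exact one_pos
  · have hρ : ρ ≠ 0 := right_ne_zero_of_mul h
    have hpos : 0 < |ρ * q| := abs_pos.2 (by rwa [mul_comm])
    have h1 : 1 - ε < 1 / |ρ * q| := by linarith [hε hρ]
    rw [lt_div_iff₀ hpos] at h1
    rw [abs_mul, abs_of_nonneg (sub_nonneg.2 hε_one), ← mul_assoc, mul_comm |q|, ← abs_mul]
    linarith

theorem observerErrorISS_of_memLp_top {lam mu : ℝ → ℝ} {q ρ ε : ℝ}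
    (hlam : ContinuousOn lam (Icc 0 1)) (hlam_pos : ∀ x ∈ Icc (0 : ℝ) 1, 0 < lam x)
    (hmu : ContinuousOn mu (Icc 0 1)) (hmu_pos : ∀ x ∈ Icc (0 : ℝ) 1, 0 < mu x)
    (hε : ρ ≠ 0 → 1 - 1 / |ρ * q| < ε) (hε_one : ε ≤ 1) {f g : Fin 4 → ℝ → ℝ}
    (hf : ∀ i, MemLp (f i) ∞ spaceMeasure) (hg : ∀ i, MemLp (g i) ∞ spaceMeasure) :
    ObserverErrorISS lam mu q ρ ε f g := by
  obtain ⟨φ, χ, h₁⟩ := exists_isTravelTime hlam hlam_pos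
  obtain ⟨ψ, ω, h₂⟩ := exists_isTravelTime hmu.reflect fun x hx => hmu_pos _ (reflect_mem_Icc hx)
  rw [transportTime_reflect] at h₂
  have hk := abs_mul_lt_one_of_reflection hε hε_one
  obtain ⟨C', hC', hest⟩ := exists_stateNorm_le hlam_pos hmu_pos h₁ h₂ hf hg hk
  -- Adding one, here and to `C` below, makes the constants positive, since class 𝒦 functions must
  -- increase strictly.
  refine ⟨fun r => (C' + 1) * r, isClassK_const_mul (by positivity), ⟨C' + 1, fun _ _ => rfl⟩,
    fun ν hν hrate => ?_⟩
  have hloop : |q| * |ρ * (1 - ε)| * Real.exp (ν * (transportTime lam + transportTime mu)) ≤ 1 := by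
    rw [← abs_mul, ← mul_assoc]
    rcases eq_or_ne (q * ρ * (1 - ε)) 0 with h | h
    · rw [h, abs_zero, zero_mul]; exact zero_le_one
    · have hτ : transportTime lam + transportTime mu ≠ 0 :=
        (add_pos h₁.time_pos h₂.time_pos).ne'
      have hpos : 0 < |q * ρ * (1 - ε)| := abs_pos.2 h
      -- At the prescribed rate, the growth over one round trip is exactly the reciprocal of the
      -- loop gain.
      rw [hrate h, div_mul_cancel₀ _ hτ, Real.exp_log (one_div_pos.2 hpos),
        mul_one_div_cancel hpos.ne']
  obtain ⟨C, hC, hest⟩ := hest ν hν.le hloop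
  refine ⟨fun r t => (C + 1) * Real.exp (-(ν * t)) * r, isClassKL_exp (by positivity) hν,
    ⟨C + 1, fun _ _ _ _ => rfl⟩, fun α₀ β₀ n d hα₀ hβ₀ hn hd =>
    ⟨exists_isObserverErrorSolution hlam hmu hlam_pos hmu_pos h₁ h₂ hf hg hα₀ hβ₀ hn hd,
      fun α β hsol t ht => (hest α₀ β₀ n d α β hα₀ hβ₀ hn hd hsol t ht).trans ?_⟩⟩
  have hR : 0 ≤ stateNorm α₀ β₀ := ENNReal.toReal_nonneg
  have hD : 0 ≤ inputNorm n d t := ENNReal.toReal_nonneg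
  simp only
  gcongr <;> linarith

theorem mainTheorem5 (lam mu : ℝ → ℝ) (q ρ ε : ℝ)
    (hlam_lip : ∃ L, LipschitzOnWith L lam (Icc 0 1)) (hlam_pos : ∀ x ∈ Icc (0 : ℝ) 1, 0 < lam x)
    (hmu_lip : ∃ L, LipschitzOnWith L mu (Icc 0 1)) (hmu_pos : ∀ x ∈ Icc (0 : ℝ) 1, 0 < mu x)
    (hq : q ≠ 0) (hε : ρ ≠ 0 → 1 - 1 / |ρ * q| < ε) (hε_one : ε ≤ 1) :
    (∀ f g : Fin 4 → ℝ → ℝ,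
      (∀ i, MemLp (f i) ∞ spaceMeasure) → (∀ i, MemLp (g i) ∞ spaceMeasure) →
        ObserverErrorISS lam mu q ρ ε f g) ∧
    (∀ (Puu Puv Pvu Pvv : ℝ → ℝ → ℝ) (m₁ m₂ : ℝ → ℝ) (f g : Fin 4 → ℝ → ℝ),
      IsBoundedKernel Puu → IsBoundedKernel Puv → IsBoundedKernel Pvu → IsBoundedKernel Pvv →
      ContinuousOn m₁ (Icc 0 1) → (∀ x ∈ Icc (0 : ℝ) 1, 0 ≤ m₁ x) →
      ContinuousOn m₂ (Icc 0 1) → (∀ x ∈ Icc (0 : ℝ) 1, 0 ≤ m₂ x) →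
      IsBacksteppingSource lam mu ρ ε Puu Puv Pvu Pvv m₁ m₂ f g →
        ObserverErrorISS lam mu q ρ ε f g) := by
  obtain ⟨L, hlam⟩ := hlam_lip
  obtain ⟨L', hmu⟩ := hmu_lip
  have key : ∀ f g : Fin 4 → ℝ → ℝ, (∀ i, MemLp (f i) ∞ spaceMeasure) →
      (∀ i, MemLp (g i) ∞ spaceMeasure) → ObserverErrorISS lam mu q ρ ε f g := fun f g hf hg =>
    observerErrorISS_of_memLp_top hlam.continuousOn hlam_pos hmu.continuousOn hmu_pos hε hε_one
      hf hg
  refine ⟨key, fun Puu Puv Pvu Pvv m₁ m₂ f g huu huv hvu hvv hm₁ _ hm₂ _ h => ?_⟩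
  have hmem := h.memLp_top huu huv hvu hvv hm₁ hm₂
  exact key f g (fun i => (hmem i).1) fun i => (hmem i).2
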